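/- Let $\mathbb N$ denote the positive integers. For $v,w\in\mathbb N$, real $t\ge 1$ and functions $\psi,\theta:\mathbb N\to\mathbb R_{\ge 0}$ write $$\omega_t(v,w)=\Big|\Big\{p\le t \text{ prime}: p\,\Big|\,\frac{vw}{\gcd(v,w)^2}\Big\}\Big|,\qquad D_{\psi,\theta}(v,w)=\frac{\max(w\psi(v),\,v\theta(w))}{\gcd(v,w)},\qquad \operatorname{Log} t=\max\{1,\log t\}.$$ For $f,g:\mathbb N\to\mathbb R_{\ge0}$, finitely supported $\psi,\theta$, and sets $V,W\subset\mathbb N$, $\mathcal E\subset\mathbb N\times\mathbb N$, write $$\mu_\psi^f(V)=\sum_{v\in V}\frac{f(v)\psi(v)}{v},\qquad \mu_\theta^g(W)=\sum_{w\in W}\frac{g(w)\theta(w)}{w},\qquad \mu_{\psi,\theta}^{f,g}(\mathcal E)=\sum_{(v,w)\in\mathcal E}\frac{f(v)\psi(v)}{v}\cdot\frac{g(w)\theta(w)}{w}.$$ **Theorem.** Let $\epsilon\in(0,2/5]$ and $C>0$. There is a real number $p_0=p_0(\epsilon,C)>0$, depending only on $\epsilon$ and $C$, such that the following holds. Let $\psi,\theta:\mathbb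 N\to\mathbb R_{\ge0}$ be finitely supported, let $\mathcal P_{\psi,\theta}$ be the set of primes $p$ such that $p\mid vw$ for some $(v,w)\in\operatorname{supp}\psi\times\operatorname{supp}\theta$, and let $P_{\psi,\theta}=p_0+|\mathcal P_{\psi,\theta}\cap[1,p_0]|$. Let $f,g:\mathbb N\to\mathbb R_{\ge0}$ be multiplicative functions such that $\sum_{d\mid n}f(d)\le n$ and $\sum_{d\mid n}g(d)\le n$ for all $n\ge1$. Let $t\ge1$ and $K\in\mathbb R$, let $V,W\subset\mathbb N$ (for instance $V=\operatorname{supp}\psi$ and $W=\operatorname{supp}\theta$), and let $\mathcal E$ be any set of pairs $(v,w)\in V\times W$ with $v\in\operatorname{supp}\psi$, $w\in\operatorname{supp}\theta$, $D_{\psi,\theta}(v,w)\le1$ and $\omega_t(v,w)\ge K$. Then $$\mu_{\psi,\theta}^{f,g}(\mathcal E)\le(100e^{C})^{P_{\psi,\theta}}\,(\operatorname{Log}t)^{\frac12(e^{40C}-1)}\,\big(\mu_\psi^f(V)\,\mu_\theta^g(W)\,e^{-CK}\big)^{\frac12+\epsilon}.$$ -/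

import Mathlib

/- The positive integers are modelled inside `ℕ`: a function `ψ` on the positive integers is
regarded as a function `ψ : ℕ → ℝ` with `ψ 0 = 0`. -/

namespace DuffinSchaeffer

noncomputable section

/-- `Log t = max {1, log t}`. -/
def Log (t : ℝ) : ℝ := max 1 (Real.log t)

/-- `ω_t(v, w)`, the number of primes `p ≤ t` dividing `v w / gcd(v, w) ^ 2`
(the division is exact). -/
def omega (t : ℝ) (v w : ℕ) : ℕ :=
  ((v * w / Nat.gcd v w ^ 2).primeFactors.filter (fun p : ℕ => (p : ℝ) ≤ t)).card

/-- `D_{ψ,θ}(v, w) = max (w ψ(v), v θ(w)) / gcd(v, w)`. -/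
def D (ψ θ : ℕ → ℝ) (v w : ℕ) : ℝ :=
  max ((w : ℝ) * ψ v) ((v : ℝ) * θ w) / (Nat.gcd v w : ℝ)

/-- The weight `μ_ψ^f(v) = f(v) ψ(v) / v` of a single integer. -/
def weight (f ψ : ℕ → ℝ) (v : ℕ) : ℝ := f v * ψ v / (v : ℝ)

/-- The weight `μ_ψ^f(V)` of a set of integers; the sum has finitely many nonzero terms as soon as
`ψ` is finitely supported. -/
def measure (f ψ : ℕ → ℝ) (V : Set ℕ) : ℝ := ∑ᶠ v ∈ V, weight f ψ v

/-- The weight `μ_{ψ,θ}^{f,g}(E)` of a set of pairs of integers; the sum has finitely many nonzero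
terms as soon as `ψ` and `θ` are finitely supported. -/
def pairMeasure (f g ψ θ : ℕ → ℝ) (E : Set (ℕ × ℕ)) : ℝ :=
  ∑ᶠ x ∈ E, weight f ψ x.1 * weight g θ x.2

/-- The set `ℰ_{ψ,θ}^{t,K}` of pairs `(v, w) ∈ supp ψ × supp θ` with `D_{ψ,θ}(v, w) ≤ 1` and
`ω_t(v, w) ≥ K`. -/
def pairSet (ψ θ : ℕ → ℝ) (t K : ℝ) : Set (ℕ × ℕ) :=
  {x | x.1 ∈ Function.support ψ ∧ x.2 ∈ Function.support θ ∧
    D ψ θ x.1 x.2 ≤ 1 ∧ K ≤ (omega t x.1 x.2 : ℝ)}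

/-- The set `𝒫_{ψ,θ}` of primes dividing `v w` for some `(v, w) ∈ supp ψ × supp θ`. -/
def primeSet (ψ θ : ℕ → ℝ) : Set ℕ :=
  {p | p.Prime ∧ ∃ v ∈ Function.support ψ, ∃ w ∈ Function.support θ, p ∣ v * w}

/-- `P_{ψ,θ} = p₀ + |𝒫_{ψ,θ} ∩ [1, p₀]|`. -/
def primeBound (p₀ : ℝ) (ψ θ : ℕ → ℝ) : ℝ :=
  p₀ + (({p ∈ primeSet ψ θ | (p : ℝ) ∈ Set.Icc 1 p₀}.ncard : ℕ) : ℝ)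

end

end DuffinSchaeffer

/-!
The bound is proved for weighted bipartite graphs between two finite sets of exponent vectors
(`IsSystem`). The functions `ψ`, `θ` enter only through the inequalities
`weight f ψ v ≤ f(v) / lcm(v, w)` and `weight g θ w ≤ g(w) / lcm(v, w)` on the edges, which is what
`D ψ θ v w ≤ 1` says, and the exponents at a prime can be frozen one prime at a time. Throughout,
`s = 1 / 2 - ε` and `q = 1 / 2 + ε`, so that `s + q = 1`.

The proof is an induction on the set `S` of primes that matter (`exists_mass_le`). Let `p ∈ S`, let
`αᵢ` and `βⱼ` be the shares of the vertices with exponent `i`, resp. `j`, at `p`. The induction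
hypothesis, applied to the edges with exponents `i`, `j` at `p`, bounds their mass by the
desired bound times `p ^ (-|i - j| s) (αᵢ βⱼ) ^ q`, times at most `e ^ C` if `i ≠ j`
(`bound_restrict_le`). Schur's test shows that the sum over `i`, `j` is at most `100 e ^ C`, which
is affordable for `p ≤ p₀`. If all primes of `S` exceed `p₀` and the bound fails, then that sum is
at least `1` for every `p ∈ S`, and this forces nearly all the mass to one exponent `k p`: the edges
with both exponents different from `k p` carry a proportion `O(p ^ (-1 - 2 ε))` of the mass
(`exists_concentration`). The series over `p` converges, so these edges can be dropped for all `p`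
at once.

Put `N = ∏ p ^ k p`. On the remaining edges at least one of the two exponents is `k p`, for every
`p`, and, after passing to half of the mass and possibly exchanging the two sides, `v` differs from
`N` at no fewer than `K / 2` primes up to `t`. In a subgraph of large minimal degree choose `w`
whose excess over `N` is maximal, and a neighbour `v` of `w` whose excess is maximal. The hypothesis
`∑ d ∣ n, f d ≤ n` bounds the degree of `w` by `excess v / excess w`, up to a factor
`e ^ (-τ K / 2)` and a squared Euler product from an exponential moment, and the degree of `v` by
`excess w / excess v` (`degree_le`). The product of the two degrees is therefore controlled, which
gives a square root bound for the mass (`IsSystem.mass_sq_le`). Interpolating it with the trivial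
bound (`le_of_sq_le_of_le`) and bounding the Euler product with Chebyshev's estimate contradicts the
assumption that the bound fails.
-/

namespace DuffinSchaeffer

open Finset

/-! ### Kernels decaying off the diagonal -/

lemma sum_pow_le_of_injOn {r : ℝ} (hr0 : 0 ≤ r) (hr1 : r < 1) (I : Finset ℕ) (e : ℕ → ℕ)
    (he : Set.InjOn e I) : ∑ j ∈ I, r ^ e j ≤ (1 - r)⁻¹ := by
  rw [← Finset.sum_image (f := fun m => r ^ m) he, ← tsum_geometric_of_lt_one hr0 hr1]
  exact (summable_geometric_of_lt_one hr0 hr1).sum_le_tsum _ fun m _ => pow_nonneg hr0 m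

lemma sum_pow_dist_le {r : ℝ} (hr0 : 0 ≤ r) (hr1 : r < 1) (I : Finset ℕ) (i : ℕ) :
    ∑ j ∈ I.erase i, r ^ Nat.dist i j ≤ 2 * r / (1 - r) := by
  have key : ∀ (J : Finset ℕ) (e : ℕ → ℕ), Set.InjOn e J →
      (∀ j ∈ J, Nat.dist i j = e j + 1) → ∑ j ∈ J, r ^ Nat.dist i j ≤ r * (1 - r)⁻¹ := by
    intro J e he h
    calc ∑ j ∈ J, r ^ Nat.dist i j = r * ∑ j ∈ J, r ^ e j := by
          rw [Finset.mul_sum]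
          refine Finset.sum_congr rfl fun j hj => ?_
          rw [h j hj]; ring
      _ ≤ _ := mul_le_mul_of_nonneg_left (sum_pow_le_of_injOn hr0 hr1 J e he) hr0
  rw [← Finset.sum_filter_add_sum_filter_not (I.erase i) (fun j => j < i)]
  have h1 := key ((I.erase i).filter (fun j => j < i)) (fun j => i - j - 1)
    (by intro a ha b hb h; simp at ha hb h; omega)
    (by intro j hj; simp at hj; simp only [Nat.dist]; omega)
  have h2 := key ((I.erase i).filter (fun j => ¬ j < i)) (fun j => j - i - 1)
    (by intro a ha b hb h; simp at ha hb h; omega)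
    (by intro j hj; simp at hj; simp only [Nat.dist]; omega)
  have : 2 * r / (1 - r) = r * (1 - r)⁻¹ + r * (1 - r)⁻¹ := by rw [div_eq_mul_inv]; ring
  linarith

lemma sum_pow_dist_le' {r : ℝ} (hr0 : 0 ≤ r) (hr1 : r < 1) (I : Finset ℕ) (i : ℕ) :
    ∑ j ∈ I, r ^ Nat.dist i j ≤ (1 + r) / (1 - r) := by
  have h := sum_pow_dist_le hr0 hr1 I i
  have h1 : (1 + r) / (1 - r) = 1 + 2 * r / (1 - r) := by
    have : 1 - r ≠ 0 := by linarith
    field_simp; ring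
  have h2 : ∑ j ∈ I, r ^ Nat.dist i j ≤ 1 + ∑ j ∈ I.erase i, r ^ Nat.dist i j := by
    by_cases hi : i ∈ I
    · rw [← Finset.add_sum_erase I _ hi, Nat.dist_self, pow_zero]
    · rw [Finset.erase_eq_of_notMem hi]; linarith
  linarith

lemma rpow_mul_le_half_add {u v q : ℝ} (hu : 0 ≤ u) (hv : 0 ≤ v) (hu1 : u ≤ 1) (hv1 : v ≤ 1)
    (hq : 1 / 2 ≤ q) : (u * v) ^ q ≤ (u + v) / 2 := by
  have h0 : 0 ≤ u * v := mul_nonneg hu hv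
  have h1 : (u * v) ^ q ≤ (u * v) ^ (1 / 2 : ℝ) :=
    Real.rpow_le_rpow_of_exponent_ge' h0 (mul_le_one₀ hu1 hv hv1) (by norm_num) hq
  have h2 : (u * v) ^ (1 / 2 : ℝ) ≤ (u + v) / 2 := by
    rw [← Real.sqrt_eq_rpow]
    apply Real.sqrt_le_iff.2
    constructor
    · positivity
    · nlinarith [sq_nonneg (u - v)]
  exact h1.trans h2

/-- Schur's test in an additive form, for a symmetric kernel with row sums at most `R`. -/
lemma sum_kernel_half_add_le {I : Finset ℕ} {κ : ℕ → ℕ → ℝ} {R : ℝ} {α β : ℕ → ℝ}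
    (hsymm : ∀ i j, κ i j = κ j i)
    (hR : ∀ i ∈ I, ∑ j ∈ I, κ i j ≤ R)
    (hα : ∀ i, 0 ≤ α i) (hβ : ∀ i, 0 ≤ β i) :
    ∑ i ∈ I, ∑ j ∈ I, κ i j * ((α i + β j) / 2) ≤ R * ((∑ i ∈ I, α i + ∑ i ∈ I, β i) / 2) := by
  have h1 : ∑ i ∈ I, ∑ j ∈ I, κ i j * ((α i + β j) / 2)
      = (∑ i ∈ I, (∑ j ∈ I, κ i j) * α i + ∑ j ∈ I, (∑ i ∈ I, κ j i) * β j) / 2 := by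
    have e1 : ∑ j ∈ I, (∑ i ∈ I, κ j i) * β j = ∑ i ∈ I, ∑ j ∈ I, κ i j * β j := by
      rw [Finset.sum_comm]
      refine Finset.sum_congr rfl fun j _ => ?_
      rw [Finset.sum_mul]
      exact Finset.sum_congr rfl fun i _ => by rw [hsymm]
    rw [e1, ← Finset.sum_add_distrib, Finset.sum_div]
    refine Finset.sum_congr rfl fun i _ => ?_
    rw [Finset.sum_mul, ← Finset.sum_add_distrib, Finset.sum_div]
    exact Finset.sum_congr rfl fun j _ => by ring
  have h2 : ∑ i ∈ I, (∑ j ∈ I, κ i j) * α i ≤ R * ∑ i ∈ I, α i := by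
    rw [Finset.mul_sum]
    exact Finset.sum_le_sum fun i hi => mul_le_mul_of_nonneg_right (hR i hi) (hα i)
  have h3 : ∑ i ∈ I, (∑ j ∈ I, κ i j) * β i ≤ R * ∑ i ∈ I, β i := by
    rw [Finset.mul_sum]
    exact Finset.sum_le_sum fun i hi => mul_le_mul_of_nonneg_right (hR i hi) (hβ i)
  rw [h1]; linarith

/-- Schur's test, after normalizing both vectors: `(u v) ^ q ≤ (u + v) / 2` for `u, v ∈ [0, 1]`. -/
lemma sum_kernel_rpow_le {I : Finset ℕ} {κ : ℕ → ℕ → ℝ} {R q : ℝ} {α β : ℕ → ℝ}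
    (hκ : ∀ i j, 0 ≤ κ i j) (hsymm : ∀ i j, κ i j = κ j i)
    (hR : ∀ i ∈ I, ∑ j ∈ I, κ i j ≤ R) (hq : 1 / 2 ≤ q)
    (hα : ∀ i, 0 ≤ α i) (hβ : ∀ i, 0 ≤ β i) :
    ∑ i ∈ I, ∑ j ∈ I, κ i j * (α i * β j) ^ q
      ≤ R * ((∑ i ∈ I, α i) * ∑ i ∈ I, β i) ^ q := by
  have hq0 : q ≠ 0 := by linarith
  set x := ∑ i ∈ I, α i with hx
  set y := ∑ i ∈ I, β i with hy
  have hx0 : 0 ≤ x := Finset.sum_nonneg fun i _ => hα i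
  have hy0 : 0 ≤ y := Finset.sum_nonneg fun i _ => hβ i
  rcases hx0.eq_or_lt with hx1 | hx1
  · have h0 := (Finset.sum_eq_zero_iff_of_nonneg fun i _ => hα i).1 (hx.symm.trans hx1.symm)
    rw [← hx1, zero_mul, Real.zero_rpow hq0, mul_zero]
    refine (Finset.sum_eq_zero fun i hi => Finset.sum_eq_zero fun j _ => ?_).le
    rw [h0 i hi, zero_mul, Real.zero_rpow hq0, mul_zero]
  rcases hy0.eq_or_lt with hy1 | hy1
  · have h0 := (Finset.sum_eq_zero_iff_of_nonneg fun i _ => hβ i).1 (hy.symm.trans hy1.symm)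
    rw [← hy1, mul_zero, Real.zero_rpow hq0, mul_zero]
    refine (Finset.sum_eq_zero fun i _ => Finset.sum_eq_zero fun j hj => ?_).le
    rw [h0 j hj, mul_zero, Real.zero_rpow hq0, mul_zero]
  calc ∑ i ∈ I, ∑ j ∈ I, κ i j * (α i * β j) ^ q
      ≤ ∑ i ∈ I, ∑ j ∈ I, (x * y) ^ q * (κ i j * ((α i / x + β j / y) / 2)) := by
        refine Finset.sum_le_sum fun i hi => Finset.sum_le_sum fun j hj => ?_
        have e : (α i * β j) ^ q = (x * y) ^ q * (α i / x * (β j / y)) ^ q := by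
          rw [← Real.mul_rpow (by positivity)
            (mul_nonneg (div_nonneg (hα i) hx0) (div_nonneg (hβ j) hy0))]
          congr 1; field_simp
        have h1 : α i / x ≤ 1 :=
          (div_le_one hx1).2 (Finset.single_le_sum (fun i _ => hα i) hi)
        have h2 : β j / y ≤ 1 :=
          (div_le_one hy1).2 (Finset.single_le_sum (fun i _ => hβ i) hj)
        have h3 := rpow_mul_le_half_add (div_nonneg (hα i) hx0) (div_nonneg (hβ j) hy0) h1 h2 hq
        rw [e, mul_left_comm]
        exact mul_le_mul_of_nonneg_left (mul_le_mul_of_nonneg_left h3 (hκ i j)) (by positivity)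
    _ = (x * y) ^ q * ∑ i ∈ I, ∑ j ∈ I, κ i j * ((α i / x + β j / y) / 2) := by
        simp only [Finset.mul_sum]
    _ ≤ (x * y) ^ q * (R * ((∑ i ∈ I, α i / x + ∑ i ∈ I, β i / y) / 2)) := by
        refine mul_le_mul_of_nonneg_left ?_ (by positivity)
        exact sum_kernel_half_add_le hsymm hR (fun i => div_nonneg (hα i) hx0)
          (fun i => div_nonneg (hβ i) hy0)
    _ = R * (x * y) ^ q := by
        rw [← Finset.sum_div, ← Finset.sum_div, ← hx, ← hy, div_self hx1.ne', div_self hy1.ne']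
        ring

/-- Hölder's inequality in the form with exponents `s + q = 1`. -/
lemma sum_rpow_mul_rpow_le {ι : Type*} (I : Finset ι) {s q : ℝ} (hs : 0 < s) (hq : 0 < q)
    (hsq : s + q = 1) (u v : ι → ℝ) (hu : ∀ i ∈ I, 0 ≤ u i) (hv : ∀ i ∈ I, 0 ≤ v i) :
    ∑ i ∈ I, u i ^ s * v i ^ q ≤ (∑ i ∈ I, u i) ^ s * (∑ i ∈ I, v i) ^ q := by
  have hpq : Real.HolderConjugate s⁻¹ q⁻¹ := by
    rw [Real.holderConjugate_iff]
    refine ⟨(one_lt_inv₀ hs).2 (by linarith), by simpa using hsq⟩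
  have h := Real.inner_le_Lp_mul_Lq_of_nonneg I hpq
    (f := fun i => u i ^ s) (g := fun i => v i ^ q)
    (fun i hi => Real.rpow_nonneg (hu i hi) _) (fun i hi => Real.rpow_nonneg (hv i hi) _)
  have e1 : ∑ i ∈ I, (u i ^ s) ^ s⁻¹ = ∑ i ∈ I, u i :=
    Finset.sum_congr rfl fun i hi => Real.rpow_rpow_inv (hu i hi) hs.ne'
  have e2 : ∑ i ∈ I, (v i ^ q) ^ q⁻¹ = ∑ i ∈ I, v i :=
    Finset.sum_congr rfl fun i hi => Real.rpow_rpow_inv (hv i hi) hq.ne'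
  simpa [e1, e2] using h

/-- The kernel `r ^ |i - j|`, multiplied by `Z` off the diagonal. With `r = p ^ (-s)` and
`Z = e ^ C` it weighs the pairs with exponents `i`, `j` at a prime `p`. -/
noncomputable def kernel (Z r : ℝ) (i j : ℕ) : ℝ := r ^ Nat.dist i j * if i = j then 1 else Z

lemma kernel_nonneg {Z r : ℝ} (hZ : 1 ≤ Z) (hr : 0 ≤ r) (i j : ℕ) : 0 ≤ kernel Z r i j := by
  unfold kernel; split_ifs <;> positivity

lemma kernel_symm (Z r : ℝ) (i j : ℕ) : kernel Z r i j = kernel Z r j i := by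
  simp only [kernel, Nat.dist_comm i j, eq_comm (a := i)]

lemma kernel_le {Z r : ℝ} (hZ : 1 ≤ Z) (hr : 0 ≤ r) (i j : ℕ) :
    kernel Z r i j ≤ Z * r ^ Nat.dist i j := by
  unfold kernel
  have := pow_nonneg hr (Nat.dist i j)
  split_ifs <;> nlinarith

lemma sum_kernel_le {Z r : ℝ} (hZ : 1 ≤ Z) (hr0 : 0 ≤ r) (hr1 : r < 1) (I : Finset ℕ) (i : ℕ) :
    ∑ j ∈ I, kernel Z r i j ≤ Z * ((1 + r) / (1 - r)) := by
  refine (Finset.sum_le_sum fun j _ => kernel_le hZ hr0 i j).trans ?_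
  rw [← Finset.mul_sum]
  exact mul_le_mul_of_nonneg_left (sum_pow_dist_le' hr0 hr1 I i) (by linarith)

/-! ### Concentration at a single exponent -/

/-- If the kernel sum is at least `1`, a single index carries almost all of the mass of both
probability vectors: off the diagonal the kernel is small, and on it the exponent exceeds `1/2`. -/
lemma exists_large_index {ε Z r η : ℝ} (hε : 0 < ε) (hZ : 1 ≤ Z) (hr0 : 0 ≤ r) (hr1 : r < 1)
    (hr : Z * (2 * r / (1 - r)) < 1 - (1 - η) ^ ε)
    {n : ℕ} {α β : ℕ → ℝ} (hα : ∀ i, 0 ≤ α i) (hβ : ∀ i, 0 ≤ β i)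
    (hα1 : ∑ i ∈ range n, α i = 1) (hβ1 : ∑ i ∈ range n, β i = 1)
    (h : 1 ≤ ∑ i ∈ range n, ∑ j ∈ range n, kernel Z r i j * (α i * β j) ^ (1 / 2 + ε)) :
    ∃ k ∈ range n, 1 - α k ≤ η ∧ 1 - β k ≤ η := by
  have hne : (range n).Nonempty := by
    by_contra hc
    rw [Finset.not_nonempty_iff_eq_empty] at hc
    simp [hc] at hα1
  obtain ⟨k, hk, hmax⟩ := Finset.exists_max_image (range n) (fun i => α i * β i) hne
  have hαle : ∀ i ∈ range n, α i ≤ 1 := fun i hi =>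
    hα1 ▸ Finset.single_le_sum (fun i _ => hα i) hi
  have hβle : ∀ i ∈ range n, β i ≤ 1 := fun i hi =>
    hβ1 ▸ Finset.single_le_sum (fun i _ => hβ i) hi
  set m := α k * β k with hm
  have hm0 : 0 ≤ m := mul_nonneg (hα k) (hβ k)
  have hdiag : ∀ i ∈ range n, kernel Z r i i * (α i * β i) ^ (1 / 2 + ε)
      ≤ m ^ ε * ((α i + β i) / 2) := by
    intro i hi
    have h0 : 0 ≤ α i * β i := mul_nonneg (hα i) (hβ i)
    rw [kernel, Nat.dist_self, pow_zero, one_mul, if_pos rfl, one_mul, add_comm,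
      Real.rpow_add_of_nonneg h0 hε.le (by norm_num)]
    exact mul_le_mul (Real.rpow_le_rpow h0 (hmax i hi) hε.le)
      (rpow_mul_le_half_add (hα i) (hβ i) (hαle i hi) (hβle i hi) le_rfl)
      (by positivity) (by positivity)
  have hoff : ∑ i ∈ range n, ∑ j ∈ (range n).erase i, kernel Z r i j * (α i * β j) ^ (1 / 2 + ε)
      ≤ Z * (2 * r / (1 - r)) := by
    have hk' := sum_kernel_half_add_le (I := range n)
      (κ := fun i j => if i = j then 0 else Z * r ^ Nat.dist i j) (R := Z * (2 * r / (1 - r)))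
      (α := α) (β := β) (by intro i j; simp only [Nat.dist_comm i j, eq_comm (a := i)]) (by
        intro i hi
        rw [← Finset.add_sum_erase _ _ hi, if_pos rfl, zero_add]
        calc ∑ j ∈ (range n).erase i, (if i = j then 0 else Z * r ^ Nat.dist i j)
            = Z * ∑ j ∈ (range n).erase i, r ^ Nat.dist i j := by
              rw [Finset.mul_sum]
              exact Finset.sum_congr rfl fun j hj => if_neg (Finset.ne_of_mem_erase hj).symm
          _ ≤ _ := mul_le_mul_of_nonneg_left (sum_pow_dist_le hr0 hr1 _ i) (by linarith)) hα hβ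
    rw [hα1, hβ1] at hk'
    refine le_trans (Finset.sum_le_sum fun i hi => ?_) (hk'.trans (by norm_num))
    rw [← Finset.add_sum_erase _ _ hi, if_pos rfl, zero_mul, zero_add]
    refine Finset.sum_le_sum fun j hj => ?_
    rw [if_neg (Finset.ne_of_mem_erase hj).symm]
    exact mul_le_mul (kernel_le hZ hr0 i j) (rpow_mul_le_half_add (hα i) (hβ j) (hαle i hi)
      (hβle j (Finset.mem_of_mem_erase hj)) (by linarith))
      (Real.rpow_nonneg (mul_nonneg (hα i) (hβ j)) _) (by positivity)
  have htot : ∑ i ∈ range n, ∑ j ∈ range n, kernel Z r i j * (α i * β j) ^ (1 / 2 + ε)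
      ≤ m ^ ε + Z * (2 * r / (1 - r)) := by
    have : ∑ i ∈ range n, ∑ j ∈ range n, kernel Z r i j * (α i * β j) ^ (1 / 2 + ε)
        = ∑ i ∈ range n, kernel Z r i i * (α i * β i) ^ (1 / 2 + ε)
        + ∑ i ∈ range n, ∑ j ∈ (range n).erase i, kernel Z r i j * (α i * β j) ^ (1 / 2 + ε) := by
      rw [← Finset.sum_add_distrib]
      exact Finset.sum_congr rfl fun i hi => (Finset.add_sum_erase _ _ hi).symm
    have h2 : ∑ i ∈ range n, kernel Z r i i * (α i * β i) ^ (1 / 2 + ε) ≤ m ^ ε := by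
      refine (Finset.sum_le_sum hdiag).trans ?_
      rw [← Finset.mul_sum, ← Finset.sum_div, Finset.sum_add_distrib, hα1, hβ1]
      norm_num
    rw [this]
    exact add_le_add h2 hoff
  have hlt : (1 - η) ^ ε < m ^ ε := by
    generalize Z * (2 * r / (1 - r)) = T at hr htot
    linarith
  have hm1 : 1 - η < m := by
    by_contra hc
    exact absurd (Real.rpow_le_rpow hm0 (not_lt.1 hc) hε.le) (not_le.2 hlt)
  have h3 := mul_le_mul_of_nonneg_left (hβle k hk) (hα k)
  have h4 := mul_le_mul_of_nonneg_right (hαle k hk) (hβ k)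
  exact ⟨k, hk, by linarith, by linarith⟩

/-- Off the index `k`, but with one of the two exponents equal to `k`, Hölder's inequality turns
the decay of the kernel into a factor `p ^ (-s)`. -/
lemma sum_kernel_row_le {s q Z : ℝ} (hs : 0 < s) (hq : 0 < q) (hsq : s + q = 1) (hZ : 1 ≤ Z)
    {p : ℕ} (hp : 2 ≤ p) (I : Finset ℕ) (k : ℕ) {β : ℕ → ℝ} (hβ : ∀ i, 0 ≤ β i) :
    ∑ j ∈ I.erase k, kernel Z ((p : ℝ) ^ (-s)) k j * β j ^ q
      ≤ Z * ((4 / p : ℝ) ^ s * (∑ j ∈ I.erase k, β j) ^ q) := by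
  have hp0 : (0 : ℝ) < p := by positivity
  have hp2 : (2 : ℝ) ≤ p := by exact_mod_cast hp
  have hpi : (p : ℝ)⁻¹ ≤ 1 / 2 := by
    rw [one_div]; exact inv_anti₀ (by norm_num) hp2
  have hpi0 : 0 < (p : ℝ)⁻¹ := by positivity
  have hr0 : 0 ≤ (p : ℝ) ^ (-s) := by positivity
  calc ∑ j ∈ I.erase k, kernel Z ((p : ℝ) ^ (-s)) k j * β j ^ q
      ≤ ∑ j ∈ I.erase k, Z * ((((p : ℝ)⁻¹) ^ Nat.dist k j) ^ s * β j ^ q) := by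
        refine Finset.sum_le_sum fun j _ => ?_
        have e : ((p : ℝ) ^ (-s)) ^ Nat.dist k j = (((p : ℝ)⁻¹) ^ Nat.dist k j) ^ s := by
          rw [← Real.rpow_natCast, ← Real.rpow_natCast, Real.rpow_neg_eq_inv_rpow,
            ← Real.rpow_mul hpi0.le, ← Real.rpow_mul hpi0.le, mul_comm]
        have := kernel_le hZ hr0 k j
        rw [e] at this
        rw [← mul_assoc]
        exact mul_le_mul_of_nonneg_right this (Real.rpow_nonneg (hβ j) _)
    _ = Z * ∑ j ∈ I.erase k, (((p : ℝ)⁻¹) ^ Nat.dist k j) ^ s * β j ^ q := by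
        rw [Finset.mul_sum]
    _ ≤ _ := by
        refine mul_le_mul_of_nonneg_left ?_ (by linarith)
        refine (sum_rpow_mul_rpow_le _ hs hq hsq _ _ (fun j _ => by positivity)
          (fun j _ => hβ j)).trans ?_
        refine mul_le_mul_of_nonneg_right ?_
          (Real.rpow_nonneg (Finset.sum_nonneg fun j _ => hβ j) _)
        refine Real.rpow_le_rpow (Finset.sum_nonneg fun j _ => by positivity) ?_ hs.le
        refine (sum_pow_dist_le hpi0.le (by linarith) I k).trans ?_
        rw [div_le_iff₀ (by linarith), div_eq_mul_inv]
        nlinarith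

lemma sum_sum_eq_erase {I : Finset ℕ} {k : ℕ} (hk : k ∈ I) (φ : ℕ → ℕ → ℝ) :
    ∑ i ∈ I, ∑ j ∈ I, φ i j = φ k k + ∑ j ∈ I.erase k, φ k j + ∑ i ∈ I.erase k, φ i k
      + ∑ i ∈ I.erase k, ∑ j ∈ I.erase k, φ i j := by
  rw [← Finset.add_sum_erase I _ hk, ← Finset.add_sum_erase I (φ k) hk]
  have : ∀ i, ∑ j ∈ I, φ i j = φ i k + ∑ j ∈ I.erase k, φ i j :=
    fun i => (Finset.add_sum_erase I (φ i) hk).symm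
  simp only [this, Finset.sum_add_distrib]
  ring

/-- Once most of the mass sits at `k`, the remaining mass `u` satisfies
`u ≪ p ^ (-s) u ^ q`, so that `u ≪ 1 / p`, and the pairs that avoid `k` on both sides contribute
`O(u ^ (2 q))`. -/
lemma mass_off_index_le {ε Z η : ℝ} (hε : 0 < ε) (hε' : ε < 1 / 2) (hZ : 1 ≤ Z)
    (hη0 : 0 ≤ η) (hη : η ^ (2 * ε) ≤ 1 / (4 * Z))
    {p : ℕ} (hp : 2 ≤ p) (hr : (p : ℝ) ^ (-(1 / 2 - ε)) ≤ 1 / 3)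
    {n : ℕ} {α β : ℕ → ℝ} (hα : ∀ i, 0 ≤ α i) (hβ : ∀ i, 0 ≤ β i)
    (hα1 : ∑ i ∈ range n, α i = 1) (hβ1 : ∑ i ∈ range n, β i = 1)
    (h : 1 ≤ ∑ i ∈ range n, ∑ j ∈ range n,
      kernel Z ((p : ℝ) ^ (-(1 / 2 - ε))) i j * (α i * β j) ^ (1 / 2 + ε))
    {k : ℕ} (hk : k ∈ range n) (hαk : 1 - α k ≤ η) (hβk : 1 - β k ≤ η) :
    ∑ i ∈ (range n).erase k, ∑ j ∈ (range n).erase k,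
      kernel Z ((p : ℝ) ^ (-(1 / 2 - ε))) i j * (α i * β j) ^ (1 / 2 + ε)
      ≤ 2 * Z * (4 * (8 * Z) ^ (1 / 2 - ε)⁻¹ / p) ^ (1 + 2 * ε) := by
  set s := 1 / 2 - ε with hs
  set q := 1 / 2 + ε with hq
  set r := (p : ℝ) ^ (-s) with hrdef
  have hs0 : 0 < s := by linarith
  have hq0 : 0 < q := by linarith
  have hsq : s + q = 1 := by rw [hs, hq]; ring
  have hp0 : (0 : ℝ) < p := by positivity
  have hr0 : 0 ≤ r := by positivity
  set x := ∑ i ∈ (range n).erase k, α i with hx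
  set y := ∑ i ∈ (range n).erase k, β i with hy
  have hx0 : 0 ≤ x := Finset.sum_nonneg fun i _ => hα i
  have hy0 : 0 ≤ y := Finset.sum_nonneg fun i _ => hβ i
  have hax : α k + x = 1 := by rw [hx, Finset.add_sum_erase _ _ hk, hα1]
  have hby : β k + y = 1 := by rw [hy, Finset.add_sum_erase _ _ hk, hβ1]
  have hαk1 : α k ≤ 1 := by linarith
  have hβk1 : β k ≤ 1 := by linarith
  have hZ0 : 0 < Z := by linarith
  have hfar : ∑ i ∈ (range n).erase k, ∑ j ∈ (range n).erase k,
      kernel Z r i j * (α i * β j) ^ q ≤ 2 * Z * (x * y) ^ q := by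
    refine (sum_kernel_rpow_le (R := 2 * Z) (kernel_nonneg hZ hr0) (kernel_symm Z r) ?_
      (by linarith) hα hβ)
    intro i _
    refine (sum_kernel_le hZ hr0 (by linarith) _ i).trans ?_
    rw [mul_comm 2 Z]
    refine mul_le_mul_of_nonneg_left ?_ hZ0.le
    rw [div_le_iff₀ (by linarith)]
    linarith
  have hxy : (x * y) ^ q ≤ (x + y) / 2 * (1 / (4 * Z)) := by
    rw [hq, Real.rpow_add_of_nonneg (by positivity) (by norm_num) hε.le]
    refine mul_le_mul (rpow_mul_le_half_add hx0 hy0 (by linarith [hα k]) (by linarith [hβ k])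
      le_rfl) ?_ (by positivity) (by positivity)
    refine le_trans ?_ hη
    rw [Real.rpow_mul hη0]
    refine Real.rpow_le_rpow (by positivity) ?_ hε.le
    rw [Real.rpow_two, sq]
    exact mul_le_mul (by linarith) (by linarith) hy0 hη0
  have hkk : kernel Z r k k * (α k * β k) ^ q ≤ 1 - (x + y) / 2 := by
    rw [kernel, Nat.dist_self, pow_zero, one_mul, if_pos rfl, one_mul]
    have := rpow_mul_le_half_add (hα k) (hβ k) hαk1 hβk1 (q := q) (by linarith)
    linarith
  have hrow : ∑ j ∈ (range n).erase k, kernel Z r k j * (α k * β j) ^ q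
      ≤ Z * ((4 / p : ℝ) ^ s * y ^ q) := by
    refine le_trans (Finset.sum_le_sum fun j _ => ?_) (sum_kernel_row_le hs0 hq0 hsq hZ hp _ k hβ)
    refine mul_le_mul_of_nonneg_left ?_ (kernel_nonneg hZ hr0 k j)
    exact Real.rpow_le_rpow (mul_nonneg (hα k) (hβ j))
      (mul_le_of_le_one_left (hβ j) hαk1) hq0.le
  have hcol : ∑ i ∈ (range n).erase k, kernel Z r i k * (α i * β k) ^ q
      ≤ Z * ((4 / p : ℝ) ^ s * x ^ q) := by
    refine le_trans (Finset.sum_le_sum fun j _ => ?_) (sum_kernel_row_le hs0 hq0 hsq hZ hp _ k hα)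
    rw [kernel_symm]
    refine mul_le_mul_of_nonneg_left ?_ (kernel_nonneg hZ hr0 k j)
    exact Real.rpow_le_rpow (mul_nonneg (hα j) (hβ k))
      (mul_le_of_le_one_right (hα j) hβk1) hq0.le
  rw [sum_sum_eq_erase hk] at h
  set u := x + y with hu
  have hu0 : 0 ≤ u := by positivity
  have hxu : x ^ q ≤ u ^ q := Real.rpow_le_rpow hx0 (by linarith) hq0.le
  have hyu : y ^ q ≤ u ^ q := Real.rpow_le_rpow hy0 (by linarith) hq0.le
  -- The diagonal term loses `u / 2`, the far terms regain at most `u / 4`.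
  have hmain : u ≤ 8 * Z * (4 / p : ℝ) ^ s * u ^ q := by
    have h1 : 2 * Z * (x * y) ^ q ≤ u / 4 := by
      have := mul_le_mul_of_nonneg_left hxy (show 0 ≤ 2 * Z by positivity)
      refine this.trans (le_of_eq ?_)
      field_simp
    have h2 : Z * ((4 / p : ℝ) ^ s * y ^ q) ≤ Z * (4 / p : ℝ) ^ s * u ^ q := by
      rw [← mul_assoc]; exact mul_le_mul_of_nonneg_left hyu (by positivity)
    have h3 : Z * ((4 / p : ℝ) ^ s * x ^ q) ≤ Z * (4 / p : ℝ) ^ s * u ^ q := by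
      rw [← mul_assoc]; exact mul_le_mul_of_nonneg_left hxu (by positivity)
    clear hxy hη
    linarith
  have hule : u ≤ 4 * (8 * Z) ^ s⁻¹ / p := by
    rcases hu0.eq_or_lt with h0 | h0
    · rw [← h0]; positivity
    have e : u = u ^ s * u ^ q := by rw [← Real.rpow_add h0, hsq, Real.rpow_one]
    have h1 : u ^ s ≤ 8 * Z * (4 / p : ℝ) ^ s := by
      have hpos : 0 < u ^ q := by positivity
      rw [e] at hmain
      nth_rewrite 2 [← e] at hmain
      exact le_of_mul_le_mul_right hmain hpos
    have h2 : u ≤ (8 * Z * (4 / p : ℝ) ^ s) ^ s⁻¹ := by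
      rw [← Real.rpow_rpow_inv hu0 hs0.ne']
      exact Real.rpow_le_rpow (by positivity) h1 (by positivity)
    refine h2.trans (le_of_eq ?_)
    rw [Real.mul_rpow (by positivity) (by positivity), Real.rpow_rpow_inv (by positivity) hs0.ne']
    ring
  refine hfar.trans (mul_le_mul_of_nonneg_left ?_ (by positivity))
  calc (x * y) ^ q ≤ (u * u) ^ q :=
        Real.rpow_le_rpow (by positivity)
          (mul_le_mul (by linarith) (by linarith) hy0 hu0) hq0.le
    _ = u ^ (1 + 2 * ε) := by
        rw [← sq, ← Real.rpow_two, ← Real.rpow_mul hu0, hq]; congr 1; ring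
    _ ≤ _ := Real.rpow_le_rpow hu0 hule (by linarith)

/-- For large primes, a kernel sum of at least `1` confines the mass to one index `k`: the pairs
with both indices different from `k` contribute `O(p ^ (-1 - 2 ε))`, which is summable over `p`. -/
lemma exists_concentration {ε Z : ℝ} (hε : 0 < ε) (hε' : ε < 1 / 2) (hZ : 1 ≤ Z) :
    ∃ p₁ c : ℝ, ∀ p : ℕ, 2 ≤ p → p₁ < p → ∀ (n : ℕ) (α β : ℕ → ℝ),
      (∀ i, 0 ≤ α i) → (∀ i, 0 ≤ β i) →
      ∑ i ∈ range n, α i = 1 → ∑ i ∈ range n, β i = 1 →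
      1 ≤ ∑ i ∈ range n, ∑ j ∈ range n,
        kernel Z ((p : ℝ) ^ (-(1 / 2 - ε))) i j * (α i * β j) ^ (1 / 2 + ε) →
      ∃ k, ∑ i ∈ (range n).erase k, ∑ j ∈ (range n).erase k,
        kernel Z ((p : ℝ) ^ (-(1 / 2 - ε))) i j * (α i * β j) ^ (1 / 2 + ε)
        ≤ c / (p : ℝ) ^ (1 + 2 * ε) := by
  have hs0 : 0 < 1 / 2 - ε := by linarith
  have hZ0 : 0 < Z := by linarith
  -- `η` bounds the gain from pairs avoiding `k` by half of the loss on the diagonal, and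
  -- `r₀` bounds the kernel ratio so that the off-diagonal terms cannot hide a spread of the mass.
  set η : ℝ := (1 / (4 * Z)) ^ (2 * ε)⁻¹ with hη
  have hη0 : 0 < η := by positivity
  have hηle : η ^ (2 * ε) ≤ 1 / (4 * Z) :=
    (Real.rpow_inv_rpow (by positivity) (by positivity)).le
  have hη1 : η < 1 := by
    refine Real.rpow_lt_one (by positivity) ?_ (by positivity)
    rw [div_lt_one (by positivity)]; linarith
  set δ : ℝ := 1 - (1 - η) ^ ε with hδ
  have hδ0 : 0 < δ := by
    have : (1 - η) ^ ε < 1 := Real.rpow_lt_one (by linarith) (by linarith) hε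
    linarith
  set r₀ : ℝ := min (1 / 3) (δ / (8 * Z)) with hr₀
  have hr₀0 : 0 < r₀ := by positivity
  refine ⟨r₀ ^ (-(1 / 2 - ε)⁻¹), 2 * Z * (4 * (8 * Z) ^ (1 / 2 - ε)⁻¹) ^ (1 + 2 * ε),
    ?_⟩
  intro p hp hp1 n α β hα hβ hα1 hβ1 h
  have hp0 : (0 : ℝ) < p := by positivity
  have hr : (p : ℝ) ^ (-(1 / 2 - ε)) ≤ r₀ := by
    have h1 := Real.rpow_le_rpow_of_nonpos (z := -(1 / 2 - ε)) (by positivity) hp1.le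
      (by linarith)
    rwa [← Real.rpow_mul hr₀0.le, neg_mul_neg, inv_mul_cancel₀ hs0.ne', Real.rpow_one] at h1
  have hr3 : (p : ℝ) ^ (-(1 / 2 - ε)) ≤ 1 / 3 := hr.trans (min_le_left _ _)
  have hrδ : (p : ℝ) ^ (-(1 / 2 - ε)) ≤ δ / (8 * Z) := hr.trans (min_le_right _ _)
  have hr0 : 0 ≤ (p : ℝ) ^ (-(1 / 2 - ε)) := by positivity
  obtain ⟨k, hk, h1, h2⟩ := exists_large_index hε hZ hr0 (by linarith) (by
    rw [le_div_iff₀ (by positivity)] at hrδ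
    have : 2 * (p : ℝ) ^ (-(1 / 2 - ε)) / (1 - (p : ℝ) ^ (-(1 / 2 - ε)))
        ≤ 4 * (p : ℝ) ^ (-(1 / 2 - ε)) := by
      rw [div_le_iff₀ (by linarith)]
      nlinarith
    have h4 := mul_le_mul_of_nonneg_left this hZ0.le
    generalize 2 * (p : ℝ) ^ (-(1 / 2 - ε)) / (1 - (p : ℝ) ^ (-(1 / 2 - ε))) = T at h4 ⊢
    linarith) hα hβ hα1 hβ1 h
  refine ⟨k, (mass_off_index_le hε hε' hZ hη0.le hηle hp hr3 hα hβ hα1 hβ1 h hk h1 h2).trans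
    (le_of_eq ?_)⟩
  rw [Real.div_rpow (by positivity) (by positivity), mul_div_assoc]

/-! ### Sums over primes -/

lemma sum_one_div_primes_dyadic_le {m : ℕ} (hm : 1 ≤ m) (S : Finset ℕ)
    (hS : ∀ p ∈ S, p.Prime ∧ 2 ^ m < p ∧ p ≤ 2 ^ (m + 1)) :
    ∑ p ∈ S, (1 : ℝ) / p ≤ 4 / m := by
  have hlog2 : 0 < Real.log 2 := Real.log_pos (by norm_num)
  have hm0 : (0 : ℝ) < m := by exact_mod_cast hm
  have h1 : ∑ p ∈ S, Real.log p ≤ Real.log 4 * 2 ^ (m + 1) := by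
    have h := Chebyshev.theta_le_log4_mul_x (x := ((2 ^ (m + 1) : ℕ) : ℝ)) (by positivity)
    rw [Chebyshev.theta_eq_sum_Icc, Nat.floor_natCast] at h
    push_cast at h
    refine le_trans (Finset.sum_le_sum_of_subset_of_nonneg ?_ ?_) h
    · intro p hp
      obtain ⟨h1, _, h3⟩ := hS p hp
      simp [h1, h3]
    · intro p _ _
      exact Real.log_natCast_nonneg p
  have h2 : ∀ p ∈ S, (1 : ℝ) / p ≤ Real.log p * (1 / (2 ^ m * (m * Real.log 2))) := by
    intro p hp
    obtain ⟨_, h2, _⟩ := hS p hp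
    have hp' : (2 : ℝ) ^ m ≤ p := by exact_mod_cast h2.le
    have hpl : m * Real.log 2 ≤ Real.log p := by
      rw [← Real.log_pow]; exact Real.log_le_log (by positivity) hp'
    have hp0 : (0 : ℝ) < p := lt_of_lt_of_le (by positivity) hp'
    rw [mul_one_div, div_le_div_iff₀ hp0 (by positivity), one_mul, mul_comm]
    exact mul_le_mul hpl hp' (by positivity) (le_trans (by positivity) hpl)
  refine (Finset.sum_le_sum h2).trans ?_
  rw [← Finset.sum_mul]
  refine (mul_le_mul_of_nonneg_right h1 (by positivity)).trans (le_of_eq ?_)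
  have : Real.log 4 = 2 * Real.log 2 := by
    rw [show (4 : ℝ) = 2 ^ 2 by norm_num, Real.log_pow]; norm_num
  rw [this, pow_succ]
  field_simp
  norm_num

lemma sum_one_div_primes_le_pow (M : ℕ) (S : Finset ℕ)
    (hS : ∀ p ∈ S, p.Prime ∧ p ≤ 2 ^ (M + 1)) :
    ∑ p ∈ S, (1 : ℝ) / p ≤ 1 + ∑ m ∈ range M, 4 / ((m : ℝ) + 1) := by
  induction M generalizing S with
  | zero =>
    have : S ⊆ {2} := by
      intro p hp
      obtain ⟨h1, h2⟩ := hS p hp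
      have := h1.two_le
      simp at h2 ⊢; omega
    refine (Finset.sum_le_sum_of_subset_of_nonneg this fun _ _ _ => by positivity).trans ?_
    norm_num
  | succ M ih =>
    rw [Finset.sum_range_succ, ← Finset.sum_filter_add_sum_filter_not S (fun p => p ≤ 2 ^ (M + 1))]
    have h1 := ih (S.filter fun p => p ≤ 2 ^ (M + 1)) (by
      intro p hp; rw [Finset.mem_filter] at hp; exact ⟨(hS p hp.1).1, hp.2⟩)
    have h2 := sum_one_div_primes_dyadic_le (m := M + 1) (by omega)
      (S.filter fun p => ¬ p ≤ 2 ^ (M + 1)) (by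
      intro p hp; rw [Finset.mem_filter] at hp; exact ⟨(hS p hp.1).1, not_le.1 hp.2, (hS p hp.1).2⟩)
    push_cast at h2
    linarith

/-- An upper bound of Mertens type. The constant `4` in place of `1` is harmless, since the exponent
of the logarithm in the final bound leaves room for it. -/
lemma sum_one_div_primes_le {t : ℝ} (ht : 1 ≤ t) (S : Finset ℕ)
    (hS : ∀ p ∈ S, p.Prime ∧ (p : ℝ) ≤ t) :
    ∑ p ∈ S, (1 : ℝ) / p ≤ 4 * Real.log (Log t) + 10 := by
  have hL1 : 1 ≤ Log t := le_max_left _ _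
  have hLt : Real.log t ≤ Log t := le_max_right _ _
  have hlog2 : 0.69 < Real.log 2 := by linarith [Real.log_two_gt_d9]
  set M := ⌊Real.log t / Real.log 2⌋₊ with hM
  have h0 : 0 ≤ Real.log t / Real.log 2 := div_nonneg (Real.log_nonneg ht) (by linarith)
  have hMle : (M : ℝ) ≤ 2 * Log t := by
    refine (Nat.floor_le h0).trans ?_
    rw [div_le_iff₀ (by linarith)]
    nlinarith
  have hlt : Real.log t < (M + 1) * Real.log 2 := by
    rw [← div_lt_iff₀ (by linarith)]; exact Nat.lt_floor_add_one _
  have htle : t ≤ 2 ^ (M + 1) := by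
    rw [← Real.log_le_log_iff (by linarith) (by positivity), Real.log_pow]
    push_cast; exact hlt.le
  refine (sum_one_div_primes_le_pow M S fun p hp => ⟨(hS p hp).1, ?_⟩).trans ?_
  · exact_mod_cast (hS p hp).2.trans htle
  have hh : ∑ m ∈ range M, 4 / ((m : ℝ) + 1) = 4 * ((harmonic M : ℚ) : ℝ) := by
    rw [harmonic]
    push_cast
    rw [Finset.mul_sum]
    exact Finset.sum_congr rfl fun m _ => by rw [div_eq_mul_inv]
  rw [hh]
  have hharm := harmonic_le_one_add_log M
  have hlogM : Real.log M ≤ Real.log 2 + Real.log (Log t) := by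
    rcases Nat.eq_zero_or_pos M with h | h
    · rw [h, Nat.cast_zero, Real.log_zero]
      have := Real.log_nonneg hL1
      linarith
    · rw [← Real.log_mul (by norm_num) (by linarith)]
      exact Real.log_le_log (by exact_mod_cast h) hMle
  linarith [Real.log_two_lt_d9]

lemma prod_one_add_div_le {t z : ℝ} (ht : 1 ≤ t) (hz : 1 ≤ z) (S : Finset ℕ)
    (hS : ∀ p ∈ S, p.Prime ∧ (p : ℝ) ≤ t) :
    ∏ p ∈ S, (1 + (z - 1) / p) ≤ Real.exp ((z - 1) * (4 * Real.log (Log t) + 10)) := by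
  calc ∏ p ∈ S, (1 + (z - 1) / p) ≤ ∏ p ∈ S, Real.exp ((z - 1) * (1 / p)) := by
        refine Finset.prod_le_prod (fun p _ => ?_) fun p _ => ?_
        · have : 0 ≤ (z - 1) / p := div_nonneg (by linarith) (by positivity)
          linarith
        · rw [mul_one_div, add_comm]; exact Real.add_one_le_exp _
    _ = Real.exp ((z - 1) * ∑ p ∈ S, (1 : ℝ) / p) := by
        rw [← Real.exp_sum, Finset.mul_sum]
    _ ≤ _ := Real.exp_le_exp.2
        (mul_le_mul_of_nonneg_left (sum_one_div_primes_le ht S hS) (by linarith))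

/-! ### Degree bounds -/

/-- The moment bound for the number of prime factors in `S`, by expanding
`z ^ #{p ∈ S | p ∣ u}` over the subsets of `{p ∈ S | p ∣ u}`. -/
lemma sum_pow_card_dvd_le {z : ℝ} (hz : 1 ≤ z) (S : Finset ℕ) (hS : ∀ p ∈ S, p.Prime) (A : ℕ) :
    ∑ u ∈ Icc 1 A, z ^ (S.filter (fun p => p ∣ u)).card ≤ A * ∏ p ∈ S, (1 + (z - 1) / p) := by
  have hz1 : 0 ≤ z - 1 := by linarith
  have h1 : ∀ u, z ^ (S.filter (fun p => p ∣ u)).card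
      = ∑ T ∈ S.powerset, if (∏ p ∈ T, p) ∣ u then (z - 1) ^ T.card else 0 := by
    intro u
    have e1 : z ^ (S.filter (fun p => p ∣ u)).card
        = ∏ p ∈ S, (1 + if p ∣ u then z - 1 else 0) := by
      rw [Finset.card_eq_sum_ones, ← Finset.prod_pow_eq_pow_sum, Finset.prod_filter]
      refine Finset.prod_congr rfl fun p _ => ?_
      split_ifs <;> ring
    rw [e1, Finset.prod_one_add]
    refine Finset.sum_congr rfl fun T hT => ?_
    rw [Finset.mem_powerset] at hT
    have hiff : (∏ p ∈ T, p) ∣ u ↔ ∀ p ∈ T, p ∣ u :=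
      ⟨fun h p hp => (Finset.dvd_prod_of_mem _ hp).trans h,
        fun h => Finset.prod_primes_dvd u (fun p hp => (hS p (hT hp)).prime) h⟩
    split_ifs with h
    · rw [hiff] at h
      rw [Finset.card_eq_sum_ones, ← Finset.prod_pow_eq_pow_sum]
      exact Finset.prod_congr rfl fun p hp => by rw [if_pos (h p hp), pow_one]
    · rw [hiff] at h
      push Not at h
      obtain ⟨p, hp, hpu⟩ := h
      exact Finset.prod_eq_zero hp (if_neg hpu)
  simp only [h1]
  rw [Finset.sum_comm, Finset.prod_one_add, Finset.mul_sum]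
  refine Finset.sum_le_sum fun T hT => ?_
  rw [Finset.mem_powerset] at hT
  rw [← Finset.sum_filter, Finset.sum_const, nsmul_eq_mul]
  have hcard : ((Icc 1 A).filter (fun u => (∏ p ∈ T, p) ∣ u)).card = A / ∏ p ∈ T, p := by
    rw [← Nat.Ioc_filter_dvd_card_eq_div]
    rfl
  rw [hcard, Finset.prod_div_distrib, Finset.prod_const]
  have h2 := Nat.cast_div_le (α := ℝ) (m := A) (n := ∏ p ∈ T, p)
  push_cast at h2
  calc ((A / ∏ p ∈ T, p : ℕ) : ℝ) * (z - 1) ^ T.card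
      ≤ (A / ∏ p ∈ T, (p : ℝ)) * (z - 1) ^ T.card :=
        mul_le_mul_of_nonneg_right h2 (pow_nonneg hz1 _)
    _ = _ := by ring

/-- A sum of products over distinct exponent vectors is at most the product of the sums. -/
lemma sum_prod_le_prod_sum {ι : Type*} (T : Finset ι) (S : Finset ℕ) (x : ι → ℕ → ℕ)
    (hinj : ∀ v ∈ T, ∀ v' ∈ T, (∀ p ∈ S, x v p = x v' p) → v = v')
    (n : ℕ) (hn : ∀ v ∈ T, ∀ p ∈ S, x v p < n) (φ : ℕ → ℕ → ℝ) (hφ : ∀ p i, 0 ≤ φ p i) :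
    ∑ v ∈ T, ∏ p ∈ S, φ p (x v p) ≤ ∏ p ∈ S, ∑ i ∈ range n, φ p i := by
  classical
  rw [← Finset.prod_coe_sort S, Finset.prod_univ_sum]
  have hinj' : Set.InjOn (fun v (p : S) => x v p) T := by
    intro v hv v' hv' h
    exact hinj v hv v' hv' fun p hp => congrFun h ⟨p, hp⟩
  calc ∑ v ∈ T, ∏ p ∈ S, φ p (x v p)
      = ∑ y ∈ T.image (fun v (p : S) => x v p), ∏ p : S, φ p (y p) := by
        rw [Finset.sum_image hinj']
        exact Finset.sum_congr rfl fun v _ => (Finset.prod_coe_sort S fun p => φ p (x v p)).symm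
    _ ≤ _ := by
        refine Finset.sum_le_sum_of_subset_of_nonneg ?_ fun y _ _ =>
          Finset.prod_nonneg fun p _ => hφ _ _
        intro y hy
        obtain ⟨v, hv, rfl⟩ := Finset.mem_image.1 hy
        simpa [Fintype.mem_piFinset] using fun p hp => hn v hv p hp

lemma sum_le_of_eq_zero_of_ne {I : Finset ℕ} {φ : ℕ → ℝ} {i₀ : ℕ} {B : ℝ} (hB : 0 ≤ B)
    (h : ∀ i, i ≠ i₀ → φ i = 0) (h₀ : φ i₀ ≤ B) : ∑ i ∈ I, φ i ≤ B := by
  by_cases hi : i₀ ∈ I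
  · rwa [Finset.sum_eq_single_of_mem i₀ hi fun i _ hne => h i hne]
  · rw [Finset.sum_eq_zero fun i hi' => h i fun hc => hi (hc ▸ hi')]
    exact hB

/-- The local factor of the degree bound at a prime `p`: `k` is the typical exponent, `y` the
exponent of the fixed vertex, `e` the prescribed excess of the exponent `i` over `k`. -/
lemma local_factor_le {p : ℕ} (hp : p.Prime) {φ : ℕ → ℝ} (hφ0 : ∀ i, 0 ≤ φ i)
    (hφ : ∀ m, ∑ i ∈ range (m + 1), φ i ≤ (p : ℝ) ^ m) (k y e n : ℕ) {ζ : ℝ} (hζ : 1 ≤ ζ) :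
    ∑ i ∈ range n, (if i - k = e ∧ (i = k ∨ y = k) then
        (if i = k then 1 else ζ) * (φ i / (p : ℝ) ^ max i y) else 0)
      ≤ (if e = 0 then 1 else ζ) * (1 + (ζ - 1) / p) * ((p : ℝ) ^ (y - k))⁻¹ := by
  have hp0 : (0 : ℝ) < p := by exact_mod_cast hp.pos
  have hle : ∀ i, φ i ≤ (p : ℝ) ^ i := fun i =>
    (Finset.single_le_sum (fun i _ => hφ0 i) (Finset.self_mem_range_succ i)).trans (hφ i)
  have hfac : 1 ≤ 1 + (ζ - 1) / p := by
    have : 0 ≤ (ζ - 1) / p := div_nonneg (by linarith) hp0.le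
    linarith
  have he1 : (1 : ℝ) ≤ if e = 0 then 1 else ζ := by split_ifs <;> linarith
  have hrhs : 0 ≤ (if e = 0 then 1 else ζ) * (1 + (ζ - 1) / p) * ((p : ℝ) ^ (y - k))⁻¹ := by
    positivity
  -- If `y ≠ k`, only `i = k` contributes; if `y = k`, either `e > 0` determines `i`, or `i ≤ y`
  -- and the sum condition on `φ` applies, with the factor `ζ` only on the part `i < y`.
  by_cases hy : y = k
  · subst hy
    rw [Nat.sub_self, pow_zero, inv_one, mul_one]
    rw [Nat.sub_self, pow_zero, inv_one, mul_one] at hrhs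
    by_cases he : e = 0
    · subst he
      rw [if_pos rfl, one_mul]
      have h1 : ∑ i ∈ range n, (if i - y = 0 ∧ (i = y ∨ y = y) then
          (if i = y then 1 else ζ) * (φ i / (p : ℝ) ^ max i y) else 0)
          ≤ ∑ i ∈ range (y + 1), (if i = y then 1 else ζ) * (φ i / (p : ℝ) ^ y) := by
        rw [← Finset.sum_filter]
        have : ∀ i ∈ (range n).filter (fun i => i - y = 0 ∧ (i = y ∨ y = y)),
            (if i = y then 1 else ζ) * (φ i / (p : ℝ) ^ max i y)
            = (if i = y then 1 else ζ) * (φ i / (p : ℝ) ^ y) := by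
          intro i hi
          rw [Finset.mem_filter] at hi
          rw [max_eq_right (by omega)]
        rw [Finset.sum_congr rfl this]
        refine Finset.sum_le_sum_of_subset_of_nonneg ?_ ?_
        · intro i hi
          rw [Finset.mem_filter] at hi
          rw [Finset.mem_range]; omega
        · intro i _ _
          have := hφ0 i
          split_ifs <;> positivity
      refine h1.trans ?_
      have h2 : ∑ i ∈ range y, φ i ≤ (p : ℝ) ^ y / p := by
        rcases y with _ | y
        · simp
        · refine (hφ y).trans (le_of_eq ?_)
          rw [pow_succ]; field_simp
      have h3 : ∑ i ∈ range (y + 1), (if i = y then 1 else ζ) * (φ i / (p : ℝ) ^ y)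
          = (∑ i ∈ range (y + 1), φ i + (ζ - 1) * ∑ i ∈ range y, φ i) / (p : ℝ) ^ y := by
        rw [Finset.sum_range_succ, if_pos rfl, Finset.sum_range_succ]
        have : ∀ i ∈ range y, (if i = y then 1 else ζ) * (φ i / (p : ℝ) ^ y)
            = ζ / (p : ℝ) ^ y * φ i := by
          intro i hi
          rw [Finset.mem_range] at hi
          rw [if_neg (by omega)]; ring
        rw [Finset.sum_congr rfl this, ← Finset.mul_sum]
        ring
      rw [h3, div_le_iff₀ (by positivity)]
      have h4 := mul_le_mul_of_nonneg_left h2 (show 0 ≤ ζ - 1 by linarith)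
      have h5 : (1 + (ζ - 1) / p) * (p : ℝ) ^ y = (p : ℝ) ^ y + (ζ - 1) * ((p : ℝ) ^ y / p) := by
        ring
      linarith [hφ y]
    · refine sum_le_of_eq_zero_of_ne (i₀ := y + e) hrhs (fun i hi => if_neg (by omega)) ?_
      rw [if_pos (by omega), if_neg (by omega), if_neg he, max_eq_left (by omega)]
      have h1 : φ (y + e) / (p : ℝ) ^ (y + e) ≤ 1 := (div_le_one (by positivity)).2 (hle _)
      have : 0 ≤ φ (y + e) / (p : ℝ) ^ (y + e) := div_nonneg (hφ0 _) (by positivity)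
      exact mul_le_mul_of_nonneg_left (h1.trans hfac) (by linarith)
  · refine sum_le_of_eq_zero_of_ne (i₀ := k) hrhs (fun i hi => if_neg (by omega)) ?_
    by_cases h1 : k - k = e ∧ (k = k ∨ y = k)
    · have he : e = 0 := by omega
      rw [if_pos h1, if_pos rfl, if_pos he, one_mul, one_mul]
      have h3 : φ k / (p : ℝ) ^ max k y ≤ ((p : ℝ) ^ (y - k))⁻¹ := by
        rw [div_le_iff₀ (by positivity), ← div_eq_inv_mul, le_div_iff₀ (by positivity)]
        calc φ k * (p : ℝ) ^ (y - k) ≤ (p : ℝ) ^ k * (p : ℝ) ^ (y - k) :=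
              mul_le_mul_of_nonneg_right (hle k) (by positivity)
          _ = _ := by rw [← pow_add]; congr 1; omega
      exact h3.trans (le_mul_of_one_le_left (by positivity) hfac)
    · rwa [if_neg h1]

lemma factorization_prod_pow {S : Finset ℕ} (hS : ∀ p ∈ S, p.Prime) (e : ℕ → ℕ) {p : ℕ}
    (hp : p ∈ S) : (∏ q ∈ S, q ^ e q).factorization p = e p := by
  rw [Nat.factorization_prod fun q hq => pow_ne_zero _ (hS q hq).ne_zero, Finset.sum_apply',
    Finset.sum_eq_single_of_mem p hp]
  · rw [(hS p hp).factorization_pow, Finsupp.single_eq_same]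
  · intro q hq hne
    rw [(hS q hq).factorization_pow, Finsupp.single_apply, if_neg hne]

/-- The excess `∏ p ^ (x p - k p)` of an exponent vector `x` over the vector `k`: the numerator of
the reduced fraction `v / N`, where `v` and `N` have the exponents `x` and `k`. -/
def excess (S : Finset ℕ) (k x : ℕ → ℕ) : ℕ := ∏ p ∈ S, p ^ (x p - k p)

lemma excess_pos {S : Finset ℕ} (hS : ∀ p ∈ S, p.Prime) (k x : ℕ → ℕ) : 0 < excess S k x :=
  Finset.prod_pos fun p hp => pow_pos (hS p hp).pos _

open Classical in
/-- The degree bound. For a fixed excess `u` the sum over the lower part of `v` costs nothing,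
because `∑ i ≤ m, F p i ≤ p ^ m`; thus the sum is governed by the number of admissible `u ≤ A`, and
it gains the excess of the fixed vertex `y`. -/
lemma degree_le {ι : Type*} {S : Finset ℕ} (hS : ∀ p ∈ S, p.Prime) {F : ℕ → ℕ → ℝ}
    (hF0 : ∀ p i, 0 ≤ F p i) (hF : ∀ p ∈ S, ∀ m, ∑ i ∈ range (m + 1), F p i ≤ (p : ℝ) ^ m)
    (t : ℝ) {z : ℝ} (hz : 1 ≤ z) (k y : ℕ → ℕ) (T : Finset ι) (x : ι → ℕ → ℕ)
    (hinj : ∀ v ∈ T, ∀ v' ∈ T, (∀ p ∈ S, x v p = x v' p) → v = v')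
    (hxy : ∀ v ∈ T, ∀ p ∈ S, x v p = k p ∨ y p = k p)
    (A : ℕ) (hA : ∀ v ∈ T, excess S k (x v) ≤ A) :
    ∑ v ∈ T, z ^ (S.filter (fun p : ℕ => (p : ℝ) ≤ t ∧ x v p ≠ k p)).card *
        ∏ p ∈ S, (F p (x v p) / (p : ℝ) ^ max (x v p) (y p))
      ≤ A / excess S k y * (∏ p ∈ S.filter (fun p : ℕ => (p : ℝ) ≤ t), (1 + (z - 1) / p)) ^ 2 := by
  set ζ : ℕ → ℝ := fun p => if (p : ℝ) ≤ t then z else 1 with hζ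
  have hζ1 : ∀ p, 1 ≤ ζ p := by intro p; simp only [hζ]; split_ifs <;> linarith
  set φ : ℕ → ℕ → ℕ → ℝ := fun u p i =>
    if i - k p = u.factorization p ∧ (i = k p ∨ y p = k p) then
      (if i = k p then 1 else ζ p) * (F p i / (p : ℝ) ^ max i (y p)) else 0 with hφ
  have hφ0 : ∀ u p i, 0 ≤ φ u p i := by
    intro u p i
    have h1 := hF0 p i
    have h2 := hζ1 p
    simp only [hφ]
    split_ifs <;> positivity
  set Q := ∏ p ∈ S.filter (fun p : ℕ => (p : ℝ) ≤ t), (1 + (z - 1) / p) with hQ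
  have hQ' : ∏ p ∈ S, (1 + (ζ p - 1) / p) = Q := by
    rw [hQ, Finset.prod_filter]
    refine Finset.prod_congr rfl fun p _ => ?_
    simp only [hζ]
    split_ifs <;> simp
  have hQ0 : 0 ≤ Q := Finset.prod_nonneg fun p _ => by
    have : 0 ≤ (z - 1) / p := div_nonneg (by linarith) (by positivity)
    linarith
  obtain ⟨n, hn⟩ : ∃ n, ∀ v ∈ T, ∀ p ∈ S, x v p < n := by
    refine ⟨(T ×ˢ S).sup (fun e => x e.1 e.2) + 1, fun v hv p hp => Nat.lt_succ_of_le ?_⟩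
    exact Finset.le_sup (f := fun e : ι × ℕ => x e.1 e.2) (Finset.mk_mem_product hv hp)
  have hterm : ∀ v ∈ T, z ^ (S.filter (fun p : ℕ => (p : ℝ) ≤ t ∧ x v p ≠ k p)).card *
        ∏ p ∈ S, (F p (x v p) / (p : ℝ) ^ max (x v p) (y p))
      = ∏ p ∈ S, φ (excess S k (x v)) p (x v p) := by
    intro v hv
    rw [Finset.card_eq_sum_ones, ← Finset.prod_pow_eq_pow_sum, Finset.prod_filter,
      ← Finset.prod_mul_distrib]
    refine Finset.prod_congr rfl fun p hp => ?_
    have e1 : φ (excess S k (x v)) p (x v p) = (if x v p = k p then 1 else ζ p) *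
        (F p (x v p) / (p : ℝ) ^ max (x v p) (y p)) :=
      if_pos ⟨(factorization_prod_pow hS (fun p => x v p - k p) hp).symm, hxy v hv p hp⟩
    rw [e1]
    congr 1
    simp only [hζ]
    by_cases h1 : (p : ℝ) ≤ t <;> by_cases h2 : x v p = k p <;> simp [h1, h2]
  -- The vertices with a given excess `u`, summed prime by prime.
  have hfib : ∀ u ∈ Icc 1 A, ∑ v ∈ T.filter (fun v => excess S k (x v) = u),
        ∏ p ∈ S, φ (excess S k (x v)) p (x v p)
      ≤ z ^ ((S.filter (fun p : ℕ => (p : ℝ) ≤ t)).filter (fun p => p ∣ u)).card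
        * (Q * (excess S k y : ℝ)⁻¹) := by
    intro u hu
    rw [Finset.mem_Icc] at hu
    calc ∑ v ∈ T.filter (fun v => excess S k (x v) = u),
          ∏ p ∈ S, φ (excess S k (x v)) p (x v p)
        = ∑ v ∈ T.filter (fun v => excess S k (x v) = u), ∏ p ∈ S, φ u p (x v p) :=
          Finset.sum_congr rfl fun v hv => by rw [(Finset.mem_filter.1 hv).2]
      _ ≤ ∏ p ∈ S, ∑ i ∈ range n, φ u p i := by
          refine sum_prod_le_prod_sum _ S x ?_ n ?_ _ (hφ0 u)
          · intro v hv v' hv' h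
            exact hinj v (Finset.mem_filter.1 hv).1 v' (Finset.mem_filter.1 hv').1 h
          · intro v hv
            exact hn v (Finset.mem_filter.1 hv).1
      _ ≤ ∏ p ∈ S, ((if u.factorization p = 0 then 1 else ζ p) * (1 + (ζ p - 1) / p)
            * ((p : ℝ) ^ (y p - k p))⁻¹) :=
          Finset.prod_le_prod (fun p _ => Finset.sum_nonneg fun i _ => hφ0 u p i) fun p hp =>
            local_factor_le (hS p hp) (hF0 p) (hF p hp) (k p) (y p) _ n (hζ1 p)
      _ = _ := by
          rw [Finset.prod_mul_distrib, Finset.prod_mul_distrib, hQ', Finset.prod_inv_distrib,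
            mul_assoc]
          congr 1
          · rw [Finset.card_eq_sum_ones, ← Finset.prod_pow_eq_pow_sum, Finset.prod_filter,
              Finset.prod_filter]
            refine Finset.prod_congr rfl fun p hp => ?_
            have : u.factorization p = 0 ↔ ¬ p ∣ u := by
              rw [Nat.factorization_eq_zero_iff]
              have h1 := hS p hp
              have h2 : u ≠ 0 := by omega
              tauto
            simp only [this, hζ]
            by_cases h1 : (p : ℝ) ≤ t <;> by_cases h2 : p ∣ u <;> simp [h1, h2]
          · rw [excess]; push_cast; rfl
  have hmaps : ∀ v ∈ T, excess S k (x v) ∈ Icc 1 A := fun v hv =>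
    Finset.mem_Icc.2 ⟨excess_pos hS k (x v), hA v hv⟩
  rw [Finset.sum_congr rfl hterm, ← Finset.sum_fiberwise_of_maps_to hmaps]
  refine (Finset.sum_le_sum hfib).trans ?_
  rw [← Finset.sum_mul]
  refine (mul_le_mul_of_nonneg_right (sum_pow_card_dvd_le hz _
    (fun p hp => hS p (Finset.mem_filter.1 hp).1) A) (by positivity)).trans (le_of_eq ?_)
  rw [← hQ]; ring

open Classical in
/-- A weighted bipartite graph with more mass than `l` times the mass of the left vertices plus `m`
times the mass of the right ones has a nonempty subgraph with minimal degrees `l` and `m`: remove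
vertices of small degree one at a time. -/
lemma exists_min_degree_subgraph {ι κ : Type*} {a : ι → ℝ} {b : κ → ℝ} (ha : ∀ v, 0 ≤ a v)
    (hb : ∀ w, 0 ≤ b w) {l m : ℝ} (hl : 0 ≤ l) (hm : 0 ≤ m) (E : Finset (ι × κ))
    (h : l * ∑ v ∈ E.image Prod.fst, a v + m * ∑ w ∈ E.image Prod.snd, b w
      < ∑ e ∈ E, a e.1 * b e.2) :
    ∃ E' ⊆ E, E'.Nonempty ∧ (∀ e ∈ E', l ≤ ∑ e' ∈ E' with e'.1 = e.1, b e'.2) ∧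
      ∀ e ∈ E', m ≤ ∑ e' ∈ E' with e'.2 = e.2, a e'.1 := by
  induction E using Finset.strongInduction with
  | H E ih =>
  by_cases h1 : ∃ e ∈ E, ∑ e' ∈ E with e'.1 = e.1, b e'.2 < l
  · obtain ⟨e, he, hlt⟩ := h1
    have hss : E.filter (fun e' => ¬ e'.1 = e.1) ⊂ E :=
      Finset.filter_ssubset.2 ⟨e, he, by simp⟩
    obtain ⟨E', hE', hrest⟩ := ih _ hss (by
      have h2 : (E.filter (fun e' => ¬ e'.1 = e.1)).image Prod.fst ⊆
          (E.image Prod.fst).erase e.1 := by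
        intro v hv
        obtain ⟨e', he', rfl⟩ := Finset.mem_image.1 hv
        rw [Finset.mem_filter] at he'
        exact Finset.mem_erase.2 ⟨he'.2, Finset.mem_image_of_mem _ he'.1⟩
      have h3 : ∑ v ∈ (E.filter (fun e' => ¬ e'.1 = e.1)).image Prod.fst, a v + a e.1
          ≤ ∑ v ∈ E.image Prod.fst, a v := by
        rw [← Finset.sum_erase_add _ _ (Finset.mem_image_of_mem Prod.fst he)]
        gcongr
        exact fun v _ _ => ha v
      have h4 : ∑ w ∈ (E.filter (fun e' => ¬ e'.1 = e.1)).image Prod.snd, b w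
          ≤ ∑ w ∈ E.image Prod.snd, b w :=
        Finset.sum_le_sum_of_subset_of_nonneg
          (Finset.image_subset_image (Finset.filter_subset _ _)) fun w _ _ => hb w
      have h5 : ∑ e' ∈ E with e'.1 = e.1, a e'.1 * b e'.2 ≤ a e.1 * l := by
        rw [Finset.sum_congr rfl fun e' he' => by rw [(Finset.mem_filter.1 he').2],
          ← Finset.mul_sum]
        exact mul_le_mul_of_nonneg_left hlt.le (ha _)
      rw [← Finset.sum_filter_add_sum_filter_not E (fun e' => e'.1 = e.1)] at h
      have h6 := mul_le_mul_of_nonneg_left h3 hl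
      have h7 := mul_le_mul_of_nonneg_left h4 hm
      nlinarith)
    exact ⟨E', hE'.trans (Finset.filter_subset _ _), hrest⟩
  by_cases h2 : ∃ e ∈ E, ∑ e' ∈ E with e'.2 = e.2, a e'.1 < m
  · obtain ⟨e, he, hlt⟩ := h2
    have hss : E.filter (fun e' => ¬ e'.2 = e.2) ⊂ E :=
      Finset.filter_ssubset.2 ⟨e, he, by simp⟩
    obtain ⟨E', hE', hrest⟩ := ih _ hss (by
      have h2 : (E.filter (fun e' => ¬ e'.2 = e.2)).image Prod.snd ⊆
          (E.image Prod.snd).erase e.2 := by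
        intro v hv
        obtain ⟨e', he', rfl⟩ := Finset.mem_image.1 hv
        rw [Finset.mem_filter] at he'
        exact Finset.mem_erase.2 ⟨he'.2, Finset.mem_image_of_mem _ he'.1⟩
      have h3 : ∑ v ∈ (E.filter (fun e' => ¬ e'.2 = e.2)).image Prod.snd, b v + b e.2
          ≤ ∑ v ∈ E.image Prod.snd, b v := by
        rw [← Finset.sum_erase_add _ _ (Finset.mem_image_of_mem Prod.snd he)]
        gcongr
        exact fun v _ _ => hb v
      have h4 : ∑ w ∈ (E.filter (fun e' => ¬ e'.2 = e.2)).image Prod.fst, a w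
          ≤ ∑ w ∈ E.image Prod.fst, a w :=
        Finset.sum_le_sum_of_subset_of_nonneg
          (Finset.image_subset_image (Finset.filter_subset _ _)) fun w _ _ => ha w
      have h5 : ∑ e' ∈ E with e'.2 = e.2, a e'.1 * b e'.2 ≤ m * b e.2 := by
        rw [Finset.sum_congr rfl fun e' he' => by rw [(Finset.mem_filter.1 he').2],
          ← Finset.sum_mul]
        exact mul_le_mul_of_nonneg_right hlt.le (hb _)
      rw [← Finset.sum_filter_add_sum_filter_not E (fun e' => e'.2 = e.2)] at h
      have h6 := mul_le_mul_of_nonneg_left h3 hm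
      have h7 := mul_le_mul_of_nonneg_left h4 hl
      nlinarith)
    exact ⟨E', hE'.trans (Finset.filter_subset _ _), hrest⟩
  push Not at h1 h2
  refine ⟨E, subset_rfl, ?_, h1, h2⟩
  by_contra hc
  rw [Finset.not_nonempty_iff_eq_empty] at hc
  simp [hc] at h

/-! ### Systems of weighted exponent vectors -/

section System

variable {ι κ : Type*} {S : Finset ℕ} {F G : ℕ → ℕ → ℝ} {t : ℝ} {x : ι → ℕ → ℕ}
  {y : κ → ℕ → ℕ} {a : ι → ℝ} {b : κ → ℝ} {V : Finset ι} {W : Finset κ} {l m K : ℝ}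
  {E : Finset (ι × κ)}

lemma sum_biUnion_le {α : Type*} [DecidableEq α] (S : Finset ℕ) (T : ℕ → Finset α) {φ : α → ℝ}
    (hφ : ∀ e, 0 ≤ φ e) : ∑ e ∈ S.biUnion T, φ e ≤ ∑ p ∈ S, ∑ e ∈ T p, φ e := by
  induction S using Finset.induction_on with
  | empty => simp
  | insert p S hp ih =>
    rw [Finset.biUnion_insert, Finset.sum_insert hp]
    have h1 := Finset.sum_union_inter (s₁ := T p) (s₂ := S.biUnion T) (f := φ)
    have h2 : 0 ≤ ∑ e ∈ T p ∩ S.biUnion T, φ e := Finset.sum_nonneg fun e _ => hφ e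
    linarith

/-- A nonnegative function `F p i`, standing for the values `f (p ^ i)` of a multiplicative `f` with
`∑ d ∣ n, f d ≤ n`. Only the primes `p ∈ S` are subject to the bound. -/
structure IsLocalWeight (S : Finset ℕ) (F : ℕ → ℕ → ℝ) : Prop where
  nonneg : ∀ p i, 0 ≤ F p i
  sum_le : ∀ p ∈ S, ∀ m, ∑ i ∈ range (m + 1), F p i ≤ (p : ℝ) ^ m

lemma IsLocalWeight.mono {S T : Finset ℕ} {F : ℕ → ℕ → ℝ} (h : IsLocalWeight S F) (hT : T ⊆ S) :
    IsLocalWeight T F :=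
  ⟨h.nonneg, fun p hp => h.sum_le p (hT hp)⟩

lemma IsLocalWeight.le {S : Finset ℕ} {F : ℕ → ℕ → ℝ} (h : IsLocalWeight S F) {p : ℕ}
    (hp : p ∈ S) (i : ℕ) : F p i ≤ (p : ℝ) ^ i :=
  (Finset.single_le_sum (fun i _ => h.nonneg p i) (Finset.self_mem_range_succ i)).trans
    (h.sum_le p hp i)

open Classical in
/-- The number of primes `p ≤ t` in `S` at which two exponent vectors differ. -/
noncomputable def diffCount (S : Finset ℕ) (t : ℝ) (x y : ℕ → ℕ) : ℕ :=
  (S.filter (fun p : ℕ => (p : ℝ) ≤ t ∧ x p ≠ y p)).card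

/-- A weighted bipartite graph with edge set `E` between `V` and `W`, seen through the primes in
`S` only. A vertex `v` has weight `a v` and exponents `x v p`, a vertex `w` has weight `b w` and
exponents `y w p`; on an edge both weights obey the bound `f(v) / lcm(v, w)`, resp.
`g(w) / lcm(v, w)`, that `D(v, w) ≤ 1` provides, up to the factors `l` and `m` that record
the contribution of the primes outside `S`. -/
structure IsSystem {ι κ : Type*} (S : Finset ℕ) (F G : ℕ → ℕ → ℝ) (t : ℝ) (x : ι → ℕ → ℕ)
    (y : κ → ℕ → ℕ) (a : ι → ℝ) (b : κ → ℝ) (V : Finset ι) (W : Finset κ) (l m K : ℝ)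
    (E : Finset (ι × κ)) : Prop where
  a_nonneg : ∀ v, 0 ≤ a v
  b_nonneg : ∀ w, 0 ≤ b w
  l_nonneg : 0 ≤ l
  m_nonneg : 0 ≤ m
  mem : ∀ e ∈ E, e.1 ∈ V ∧ e.2 ∈ W
  x_inj : ∀ v ∈ V, ∀ v' ∈ V, (∀ p ∈ S, x v p = x v' p) → v = v'
  y_inj : ∀ w ∈ W, ∀ w' ∈ W, (∀ p ∈ S, y w p = y w' p) → w = w'
  a_le : ∀ e ∈ E, a e.1 ≤ l * ∏ p ∈ S, (F p (x e.1 p) / (p : ℝ) ^ max (x e.1 p) (y e.2 p))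
  b_le : ∀ e ∈ E, b e.2 ≤ m * ∏ p ∈ S, (G p (y e.2 p) / (p : ℝ) ^ max (y e.2 p) (x e.1 p))
  le_diffCount : ∀ e ∈ E, K ≤ diffCount S t (x e.1) (y e.2)

/-- The mass of a set of edges. -/
def mass {ι κ : Type*} (a : ι → ℝ) (b : κ → ℝ) (E : Finset (ι × κ)) : ℝ := ∑ e ∈ E, a e.1 * b e.2

lemma IsSystem.mass_nonneg (h : IsSystem S F G t x y a b V W l m K E) (E' : Finset (ι × κ)) :
    0 ≤ mass a b E' :=
  Finset.sum_nonneg fun e _ => mul_nonneg (h.a_nonneg e.1) (h.b_nonneg e.2)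

lemma IsSystem.mass_mono (h : IsSystem S F G t x y a b V W l m K E) {E₁ E₂ : Finset (ι × κ)}
    (h12 : E₁ ⊆ E₂) : mass a b E₁ ≤ mass a b E₂ :=
  Finset.sum_le_sum_of_subset_of_nonneg h12 fun e _ _ =>
    mul_nonneg (h.a_nonneg e.1) (h.b_nonneg e.2)

lemma IsSystem.mass_le (h : IsSystem S F G t x y a b V W l m K E) :
    mass a b E ≤ (∑ v ∈ V, a v) * ∑ w ∈ W, b w := by
  rw [Finset.sum_mul_sum, ← Finset.sum_product']
  exact h.mass_mono fun e he => Finset.mem_product.2 (h.mem e he)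

lemma IsSystem.mono (h : IsSystem S F G t x y a b V W l m K E) {E' : Finset (ι × κ)}
    (hE : E' ⊆ E) : IsSystem S F G t x y a b V W l m K E' :=
  ⟨h.a_nonneg, h.b_nonneg, h.l_nonneg, h.m_nonneg, fun e he => h.mem e (hE he), h.x_inj, h.y_inj,
    fun e he => h.a_le e (hE he), fun e he => h.b_le e (hE he),
    fun e he => h.le_diffCount e (hE he)⟩

lemma diffCount_comm (S : Finset ℕ) (t : ℝ) (x y : ℕ → ℕ) :
    diffCount S t x y = diffCount S t y x := by
  simp only [diffCount, ne_comm]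

lemma diffCount_le_add (S : Finset ℕ) (t : ℝ) (x y k : ℕ → ℕ) :
    diffCount S t x y ≤ diffCount S t x k + diffCount S t y k := by
  classical
  unfold diffCount
  refine le_trans (Finset.card_le_card ?_) (Finset.card_union_le _ _)
  intro p hp
  simp only [Finset.mem_union, Finset.mem_filter] at hp ⊢
  by_cases h : x p = k p
  · exact Or.inr ⟨hp.1, hp.2.1, fun hc => hp.2.2 (h.trans hc.symm)⟩
  · exact Or.inl ⟨hp.1, hp.2.1, h⟩

lemma IsSystem.swap [DecidableEq ι] [DecidableEq κ] (h : IsSystem S F G t x y a b V W l m K E) :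
    IsSystem S G F t y x b a W V m l K (E.image Prod.swap) := by
  refine ⟨h.b_nonneg, h.a_nonneg, h.m_nonneg, h.l_nonneg, ?_, h.y_inj, h.x_inj, ?_, ?_, ?_⟩ <;>
    simp only [Finset.forall_mem_image, Prod.fst_swap, Prod.snd_swap]
  · exact fun e he => (h.mem e he).symm
  · exact fun e he => h.b_le e he
  · exact fun e he => h.a_le e he
  · exact fun e he => diffCount_comm S t _ _ ▸ h.le_diffCount e he

lemma mass_image_swap [DecidableEq ι] [DecidableEq κ] :
    mass b a (E.image Prod.swap) = mass a b E := by
  unfold mass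
  rw [Finset.sum_image Prod.swap_injective.injOn]
  exact Finset.sum_congr rfl fun e _ => mul_comm _ _

open Classical in
/-- `∏ (1 + (z - 1) / p)` over the primes `p ≤ t` in `S`. -/
noncomputable def eulerProd (S : Finset ℕ) (t z : ℝ) : ℝ :=
  ∏ p ∈ S.filter (fun p : ℕ => (p : ℝ) ≤ t), (1 + (z - 1) / p)

lemma eulerProd_nonneg (S : Finset ℕ) (t : ℝ) {z : ℝ} (hz : 1 ≤ z) : 0 ≤ eulerProd S t z :=
  Finset.prod_nonneg fun p _ => by
    have : 0 ≤ (z - 1) / p := div_nonneg (by linarith) (by positivity)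
    linarith

/-- The mass of a concentrated system in which the left vertices carry at least half of the
differing primes. Pass to a subgraph of large minimal degree; take `w` of largest
excess there, and a neighbour `v` of `w` of largest excess. The degree of `w` is at most
`excess v / excess w` and that of `v` is at most `excess w / excess v`, up to the stated factors, so
the product of the two degrees is under control. -/
lemma IsSystem.mass_sq_le_of_left (h : IsSystem S F G t x y a b V W l m K E)
    (hS : ∀ p ∈ S, p.Prime) (hF : IsLocalWeight S F) (hG : IsLocalWeight S G)
    {k : ℕ → ℕ} (hk : ∀ e ∈ E, ∀ p ∈ S, x e.1 p = k p ∨ y e.2 p = k p)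
    (hK : ∀ e ∈ E, K / 2 ≤ diffCount S t (x e.1) k) {τ : ℝ} (hτ : 0 ≤ τ) :
    mass a b E ^ 2 ≤ 16 * (l * m * ((∑ v ∈ V, a v) * ∑ w ∈ W, b w) * Real.exp (-(τ * K / 2)) *
      eulerProd S t (Real.exp τ) ^ 2) := by
  classical
  set A := ∑ v ∈ V, a v with hA
  set B := ∑ w ∈ W, b w with hB
  set Q := eulerProd S t (Real.exp τ) with hQ
  have hz : 1 ≤ Real.exp τ := Real.one_le_exp hτ
  have hl := h.l_nonneg
  have hm := h.m_nonneg
  have hA0 : 0 ≤ A := Finset.sum_nonneg fun v _ => h.a_nonneg v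
  have hB0 : 0 ≤ B := Finset.sum_nonneg fun w _ => h.b_nonneg w
  rcases (h.mass_nonneg E).eq_or_lt with hM | hM
  · rw [← hM, zero_pow two_ne_zero]; positivity
  have hAB : 0 < A * B := hM.trans_le h.mass_le
  have hA1 : 0 < A := pos_of_mul_pos_left hAB hB0
  have hB1 : 0 < B := pos_of_mul_pos_right hAB hA0
  -- Minimal degrees of a quarter of the average degrees: pruning loses at most half of the mass.
  obtain ⟨E', hE', hne, hdegV, hdegW⟩ := exists_min_degree_subgraph h.a_nonneg h.b_nonneg
    (l := mass a b E / (4 * A)) (m := mass a b E / (4 * B)) (by positivity) (by positivity) E (by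
      have h1 : ∑ v ∈ E.image Prod.fst, a v ≤ A :=
        Finset.sum_le_sum_of_subset_of_nonneg
          (Finset.image_subset_iff.2 fun e he => (h.mem e he).1) fun v _ _ => h.a_nonneg v
      have h2 : ∑ w ∈ E.image Prod.snd, b w ≤ B :=
        Finset.sum_le_sum_of_subset_of_nonneg
          (Finset.image_subset_iff.2 fun e he => (h.mem e he).2) fun w _ _ => h.b_nonneg w
      have h3 := mul_le_mul_of_nonneg_left h1 (show 0 ≤ mass a b E / (4 * A) by positivity)
      have h4 := mul_le_mul_of_nonneg_left h2 (show 0 ≤ mass a b E / (4 * B) by positivity)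
      have h5 : mass a b E / (4 * A) * A = mass a b E / 4 := by field_simp
      have h6 : mass a b E / (4 * B) * B = mass a b E / 4 := by field_simp
      have h7 : ∑ e ∈ E, a e.1 * b e.2 = mass a b E := rfl
      linarith)
  obtain ⟨e₀, he₀, hmax₀⟩ := Finset.exists_max_image E' (fun e => excess S k (y e.2)) hne
  obtain ⟨e₁, he₁, hmax₁⟩ := Finset.exists_max_image (E'.filter fun e => e.2 = e₀.2)
    (fun e => excess S k (x e.1)) ⟨e₀, Finset.mem_filter.2 ⟨he₀, rfl⟩⟩
  rw [Finset.mem_filter] at he₁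
  have hpos₀ : (0 : ℝ) < excess S k (y e₀.2) := by exact_mod_cast excess_pos hS k _
  have hpos₁ : (0 : ℝ) < excess S k (x e₁.1) := by exact_mod_cast excess_pos hS k _
  have hdW : ∑ e ∈ E' with e.2 = e₀.2, a e.1 ≤ l * Real.exp (-(τ * K / 2)) *
      (excess S k (x e₁.1) / excess S k (y e₀.2) * Q ^ 2) := by
    have hd := degree_le hS hF.nonneg hF.sum_le t hz k (y e₀.2) (E'.filter fun e => e.2 = e₀.2)
      (fun e => x e.1) (by
        intro e he e' he' hee
        rw [Finset.mem_filter] at he he'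
        exact Prod.ext (h.x_inj _ (h.mem e (hE' he.1)).1 _ (h.mem e' (hE' he'.1)).1 hee)
          (he.2.trans he'.2.symm)) (by
        intro e he p hp
        rw [Finset.mem_filter] at he
        rw [← he.2]
        exact hk e (hE' he.1) p hp) (excess S k (x e₁.1)) hmax₁
    refine le_trans ?_ (mul_le_mul_of_nonneg_left hd (mul_nonneg hl (Real.exp_pos _).le))
    rw [Finset.mul_sum]
    refine Finset.sum_le_sum fun e he => ?_
    rw [Finset.mem_filter] at he
    have h1 := h.a_le e (hE' he.1)
    rw [he.2] at h1
    refine h1.trans ?_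
    -- Exponential moment: `v` differs from `k` at no fewer than `K / 2` primes.
    have h2 : 1 ≤ Real.exp (-(τ * K / 2)) * Real.exp τ ^ diffCount S t (x e.1) k := by
      rw [← Real.exp_nat_mul, ← Real.exp_add]
      refine Real.one_le_exp ?_
      nlinarith [hK e (hE' he.1)]
    have h3 : 0 ≤ l * ∏ p ∈ S, (F p (x e.1 p) / (p : ℝ) ^ max (x e.1 p) (y e₀.2 p)) :=
      mul_nonneg hl (Finset.prod_nonneg fun p _ => div_nonneg (hF.nonneg _ _) (by positivity))
    have h4 := mul_le_mul_of_nonneg_left h2 h3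
    rw [mul_one] at h4
    refine h4.trans (le_of_eq ?_)
    rw [diffCount]; ring
  have hdV : ∑ e ∈ E' with e.1 = e₁.1, b e.2 ≤ m *
      (excess S k (y e₀.2) / excess S k (x e₁.1)) := by
    -- No moment is needed on this side: the degree bound is used with `z = 1`.
    have hd := degree_le hS hG.nonneg hG.sum_le t le_rfl k (x e₁.1)
      (E'.filter fun e => e.1 = e₁.1)
      (fun e => y e.2) (by
        intro e he e' he' hee
        rw [Finset.mem_filter] at he he'
        exact Prod.ext (he.2.trans he'.2.symm)
          (h.y_inj _ (h.mem e (hE' he.1)).2 _ (h.mem e' (hE' he'.1)).2 hee)) (by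
        intro e he p hp
        rw [Finset.mem_filter] at he
        rw [← he.2]
        exact (hk e (hE' he.1) p hp).symm) (excess S k (y e₀.2)) (by
        intro e he
        exact hmax₀ e (Finset.mem_filter.1 he).1)
    simp only [one_pow, one_mul, sub_self, zero_div, add_zero, Finset.prod_const_one,
      mul_one] at hd
    refine le_trans ?_ (mul_le_mul_of_nonneg_left hd hm)
    rw [Finset.mul_sum]
    refine Finset.sum_le_sum fun e he => ?_
    rw [Finset.mem_filter] at he
    have h1 := h.b_le e (hE' he.1)
    rwa [he.2] at h1
  have h1 := (hdegW e₀ he₀).trans hdW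
  have h2 := (hdegV e₁ he₁.1).trans hdV
  have h3 := mul_le_mul h1 h2 (by positivity) (by positivity)
  have h4 : mass a b E / (4 * B) * (mass a b E / (4 * A)) = mass a b E ^ 2 / (16 * (A * B)) := by
    field_simp; norm_num
  have h5 : l * Real.exp (-(τ * K / 2)) * (excess S k (x e₁.1) / excess S k (y e₀.2) * Q ^ 2) *
      (m * (excess S k (y e₀.2) / excess S k (x e₁.1)))
      = l * m * Real.exp (-(τ * K / 2)) * Q ^ 2 := by
    field_simp
  rw [h4, h5, div_le_iff₀ (by positivity)] at h3
  refine h3.trans (le_of_eq ?_)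
  ring

/-- The mass of a system that is concentrated at the exponents `k p`, in the sense that the edges
with both exponents atypical at some prime carry at most half of the mass. -/
lemma IsSystem.mass_sq_le (h : IsSystem S F G t x y a b V W l m K E)
    (hS : ∀ p ∈ S, p.Prime) (hF : IsLocalWeight S F) (hG : IsLocalWeight S G) {k : ℕ → ℕ}
    (hk : ∑ p ∈ S, mass a b (E.filter fun e => x e.1 p ≠ k p ∧ y e.2 p ≠ k p) ≤ mass a b E / 2)
    {τ : ℝ} (hτ : 0 ≤ τ) :
    mass a b E ^ 2 ≤ 256 * (l * m * ((∑ v ∈ V, a v) * ∑ w ∈ W, b w) * Real.exp (-(τ * K / 2)) *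
      eulerProd S t (Real.exp τ) ^ 2) := by
  classical
  set R := l * m * ((∑ v ∈ V, a v) * ∑ w ∈ W, b w) * Real.exp (-(τ * K / 2)) *
      eulerProd S t (Real.exp τ) ^ 2 with hR
  set E₀ := E.filter fun e => ∀ p ∈ S, x e.1 p = k p ∨ y e.2 p = k p with hE₀
  set E₁ := E₀.filter fun e => K / 2 ≤ diffCount S t (x e.1) k with hE₁
  set E₂ := E₀.filter fun e => ¬ K / 2 ≤ diffCount S t (x e.1) k with hE₂
  have hsplit : mass a b E = mass a b E₁ + mass a b E₂
      + mass a b (E.filter fun e => ¬ ∀ p ∈ S, x e.1 p = k p ∨ y e.2 p = k p) := by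
    unfold mass
    rw [hE₁, hE₂, Finset.sum_filter_add_sum_filter_not, hE₀, Finset.sum_filter_add_sum_filter_not]
  have hbad : mass a b (E.filter fun e => ¬ ∀ p ∈ S, x e.1 p = k p ∨ y e.2 p = k p)
      ≤ mass a b E / 2 := by
    refine le_trans ?_ hk
    have hsub : (E.filter fun e => ¬ ∀ p ∈ S, x e.1 p = k p ∨ y e.2 p = k p)
        ⊆ S.biUnion fun p => E.filter fun e => x e.1 p ≠ k p ∧ y e.2 p ≠ k p := by
      intro e he
      rw [Finset.mem_filter] at he
      obtain ⟨he, hne⟩ := he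
      push Not at hne
      obtain ⟨p, hp, hpe⟩ := hne
      exact Finset.mem_biUnion.2 ⟨p, hp, Finset.mem_filter.2 ⟨he, hpe⟩⟩
    refine (h.mass_mono hsub).trans ?_
    exact sum_biUnion_le _ _ fun e => mul_nonneg (h.a_nonneg _) (h.b_nonneg _)
  have h0E : E₀ ⊆ E := Finset.filter_subset _ _
  have h1E : E₁ ⊆ E := (Finset.filter_subset _ _).trans h0E
  have h2E : E₂ ⊆ E := (Finset.filter_subset _ _).trans h0E
  have hb1 : mass a b E₁ ^ 2 ≤ 16 * R := by
    refine (h.mono h1E).mass_sq_le_of_left hS hF hG (k := k) ?_ ?_ hτ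
    · intro e he
      exact (Finset.mem_filter.1 (Finset.mem_filter.1 he).1).2
    · intro e he
      exact (Finset.mem_filter.1 he).2
  have hb2 : mass a b E₂ ^ 2 ≤ 16 * R := by
    have := (h.mono h2E).swap.mass_sq_le_of_left hS hG hF (k := k) ?_ ?_ hτ
    · rw [mass_image_swap] at this
      refine this.trans (le_of_eq ?_)
      rw [hR]; ring
    · simp only [Finset.forall_mem_image, Prod.fst_swap, Prod.snd_swap]
      intro e he p hp
      exact ((Finset.mem_filter.1 (Finset.mem_filter.1 he).1).2 p hp).symm
    · simp only [Finset.forall_mem_image, Prod.fst_swap]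
      intro e he
      have h1 := (Finset.mem_filter.1 he).2
      have h2 := h.le_diffCount e (h2E he)
      have h3 : (diffCount S t (x e.1) (y e.2) : ℝ)
          ≤ diffCount S t (x e.1) k + diffCount S t (y e.2) k := by
        exact_mod_cast diffCount_le_add S t (x e.1) (y e.2) k
      linarith
  have hn1 := h.mass_nonneg E₁
  have hn2 := h.mass_nonneg E₂
  have hle : mass a b E ≤ 2 * (mass a b E₁ + mass a b E₂) := by linarith
  nlinarith [h.mass_nonneg E, sq_nonneg (mass a b E₁ - mass a b E₂)]

/-! ### Freezing the exponents at a prime -/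

lemma diffCount_le_erase {p : ℕ} (hp : p ∈ S) (t : ℝ) (x y : ℕ → ℕ) :
    diffCount S t x y ≤ diffCount (S.erase p) t x y + if x p = y p then 0 else 1 := by
  classical
  unfold diffCount
  have hins : S = insert p (S.erase p) := (Finset.insert_erase hp).symm
  split_ifs with h
  · refine Finset.card_le_card fun q hq => ?_
    rw [Finset.mem_filter] at hq ⊢
    refine ⟨Finset.mem_erase.2 ⟨?_, hq.1⟩, hq.2⟩
    rintro rfl
    exact hq.2.2 h
  · refine le_trans (Finset.card_le_card ?_) (Finset.card_insert_le p _)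
    intro q hq
    rw [Finset.mem_filter] at hq
    rw [Finset.mem_insert, Finset.mem_filter, Finset.mem_erase]
    tauto

/-- Fixing the exponents `i`, `j` at a prime `p ∈ S` gives a system over the other primes. -/
lemma IsSystem.restrict (h : IsSystem S F G t x y a b V W l m K E)
    (hF : IsLocalWeight S F) (hG : IsLocalWeight S G) {p : ℕ} (hp : p ∈ S) (i j : ℕ) :
    IsSystem (S.erase p) F G t x y a b (V.filter fun v => x v p = i) (W.filter fun w => y w p = j)
      (l * (F p i / (p : ℝ) ^ max i j)) (m * (G p j / (p : ℝ) ^ max i j))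
      (K - if i = j then 0 else 1) (E.filter fun e => x e.1 p = i ∧ y e.2 p = j) := by
  refine ⟨h.a_nonneg, h.b_nonneg,
    mul_nonneg h.l_nonneg (div_nonneg (hF.nonneg _ _) (by positivity)),
    mul_nonneg h.m_nonneg (div_nonneg (hG.nonneg _ _) (by positivity)), ?_, ?_, ?_, ?_, ?_, ?_⟩
  · intro e he
    rw [Finset.mem_filter] at he
    exact ⟨Finset.mem_filter.2 ⟨(h.mem e he.1).1, he.2.1⟩,
      Finset.mem_filter.2 ⟨(h.mem e he.1).2, he.2.2⟩⟩
  · intro v hv v' hv' hvv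
    rw [Finset.mem_filter] at hv hv'
    refine h.x_inj v hv.1 v' hv'.1 fun q hq => ?_
    by_cases hqp : q = p
    · rw [hqp, hv.2, hv'.2]
    · exact hvv q (Finset.mem_erase.2 ⟨hqp, hq⟩)
  · intro v hv v' hv' hvv
    rw [Finset.mem_filter] at hv hv'
    refine h.y_inj v hv.1 v' hv'.1 fun q hq => ?_
    by_cases hqp : q = p
    · rw [hqp, hv.2, hv'.2]
    · exact hvv q (Finset.mem_erase.2 ⟨hqp, hq⟩)
  · intro e he
    rw [Finset.mem_filter] at he
    have h1 := h.a_le e he.1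
    rw [← Finset.mul_prod_erase S _ hp, he.2.1, he.2.2, ← mul_assoc] at h1
    exact h1
  · intro e he
    rw [Finset.mem_filter] at he
    have h1 := h.b_le e he.1
    rw [← Finset.mul_prod_erase S _ hp, he.2.1, he.2.2, ← mul_assoc, max_comm j i] at h1
    exact h1
  · intro e he
    rw [Finset.mem_filter] at he
    have h1 := h.le_diffCount e he.1
    have h2 := diffCount_le_erase hp t (x e.1) (y e.2)
    rw [he.2.1, he.2.2] at h2
    have h3 : (diffCount S t (x e.1) (y e.2) : ℝ) ≤ diffCount (S.erase p) t (x e.1) (y e.2)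
        + if i = j then 0 else 1 := by exact_mod_cast h2
    linarith

/-- The right-hand side of the mass bound, without the constant and the power of the logarithm. -/
noncomputable def bound (ε C l m A B K : ℝ) : ℝ :=
  (l * m) ^ (1 / 2 - ε) * (A * B * Real.exp (-(C * K))) ^ (1 / 2 + ε)

lemma local_weights_le {F G : ℕ → ℕ → ℝ} (hF : IsLocalWeight S F) (hG : IsLocalWeight S G)
    {p : ℕ} (hp : p ∈ S) (hpp : p.Prime) (i j : ℕ) :
    F p i / (p : ℝ) ^ max i j * (G p j / (p : ℝ) ^ max i j) ≤ ((p : ℝ)⁻¹) ^ Nat.dist i j := by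
  have hp0 : (0 : ℝ) < p := by exact_mod_cast hpp.pos
  rw [div_mul_div_comm, div_le_iff₀ (by positivity), inv_pow, ← div_eq_inv_mul,
    le_div_iff₀ (by positivity)]
  calc F p i * G p j * (p : ℝ) ^ Nat.dist i j
      ≤ (p : ℝ) ^ i * (p : ℝ) ^ j * (p : ℝ) ^ Nat.dist i j := by
        refine mul_le_mul_of_nonneg_right ?_ (by positivity)
        exact mul_le_mul (hF.le hp i) (hG.le hp j) (hG.nonneg p j) (by positivity)
    _ = _ := by
        rw [← pow_add, ← pow_add, ← pow_add]
        congr 1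
        simp only [Nat.dist]; omega

/-- The bound for the restricted system, in terms of the bound for the whole one and the shares
`Aᵢ / A`, `Bⱼ / B` of the vertices. -/
lemma bound_restrict_le {ε C A B A' B' : ℝ} (hε : 0 < ε) (hε' : ε < 1 / 2) (hC : 0 < C)
    (hF : IsLocalWeight S F) (hG : IsLocalWeight S G) {p : ℕ} (hp : p ∈ S) (hpp : p.Prime)
    (hl : 0 ≤ l) (hm : 0 ≤ m) (hA : 0 < A) (hB : 0 < B) (hA' : 0 ≤ A') (hB' : 0 ≤ B') (i j : ℕ) :
    bound ε C (l * (F p i / (p : ℝ) ^ max i j)) (m * (G p j / (p : ℝ) ^ max i j)) A' B'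
      (K - if i = j then 0 else 1)
      ≤ bound ε C l m A B K *
        (kernel (Real.exp C) ((p : ℝ) ^ (-(1 / 2 - ε))) i j *
          (A' / A * (B' / B)) ^ (1 / 2 + ε)) := by
  have hp0 : (0 : ℝ) < p := by exact_mod_cast hpp.pos
  have hpi : 0 < (p : ℝ)⁻¹ := by positivity
  set s := 1 / 2 - ε with hs
  set q := 1 / 2 + ε with hq
  have hs0 : 0 < s := by linarith
  have hq0 : 0 < q := by linarith
  have hc0 : 0 ≤ F p i / (p : ℝ) ^ max i j * (G p j / (p : ℝ) ^ max i j) :=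
    mul_nonneg (div_nonneg (hF.nonneg _ _) (by positivity))
      (div_nonneg (hG.nonneg _ _) (by positivity))
  have h1 : (l * (F p i / (p : ℝ) ^ max i j) * (m * (G p j / (p : ℝ) ^ max i j))) ^ s
      ≤ (l * m) ^ s * ((p : ℝ) ^ (-s)) ^ Nat.dist i j := by
    rw [mul_mul_mul_comm, Real.mul_rpow (by positivity) hc0]
    refine mul_le_mul_of_nonneg_left ?_ (by positivity)
    have e : ((p : ℝ) ^ (-s)) ^ Nat.dist i j = (((p : ℝ)⁻¹) ^ Nat.dist i j) ^ s := by
      rw [← Real.rpow_natCast, ← Real.rpow_natCast, Real.rpow_neg_eq_inv_rpow,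
        ← Real.rpow_mul hpi.le, ← Real.rpow_mul hpi.le, mul_comm]
    rw [e]
    exact Real.rpow_le_rpow hc0 (local_weights_le hF hG hp hpp i j) hs0.le
  have h2 : (A' * B' * Real.exp (-(C * (K - if i = j then 0 else 1)))) ^ q
      ≤ (A * B * Real.exp (-(C * K))) ^ q * (A' / A * (B' / B)) ^ q
        * (if i = j then 1 else Real.exp C) := by
    have e : A' * B' * Real.exp (-(C * (K - if i = j then 0 else 1)))
        = (A * B * Real.exp (-(C * K))) * (A' / A * (B' / B))
          * Real.exp (C * if i = j then 0 else 1) := by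
      have : -(C * (K - if i = j then 0 else 1)) = -(C * K) + (C * if i = j then 0 else 1) := by
        ring
      rw [this, Real.exp_add]
      field_simp
    have hAA : 0 ≤ A' / A * (B' / B) := by positivity
    rw [e, Real.mul_rpow (by positivity) (by positivity),
      Real.mul_rpow (by positivity) hAA]
    refine mul_le_mul_of_nonneg_left ?_ (by positivity)
    split_ifs
    · rw [mul_zero, Real.exp_zero, Real.one_rpow]
    · rw [mul_one]
      calc Real.exp C ^ q ≤ Real.exp C ^ (1 : ℝ) :=
            Real.rpow_le_rpow_of_exponent_le (Real.one_le_exp hC.le) (by linarith)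
        _ = _ := Real.rpow_one _
  unfold bound kernel
  rw [← hs, ← hq]
  refine (mul_le_mul h1 h2 ?_ (by positivity)).trans (le_of_eq ?_)
  · positivity
  · ring

lemma mass_eq_sum_sum (p : ℕ) (I J : Finset ℕ) (a : ι → ℝ) (b : κ → ℝ) (E : Finset (ι × κ)) :
    mass a b (E.filter fun e => x e.1 p ∈ I ∧ y e.2 p ∈ J)
      = ∑ i ∈ I, ∑ j ∈ J, mass a b (E.filter fun e => x e.1 p = i ∧ y e.2 p = j) := by
  rw [← Finset.sum_product', mass, ← Finset.sum_fiberwise_of_maps_to (t := I ×ˢ J)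
    (g := fun e : ι × κ => (x e.1 p, y e.2 p))]
  · refine Finset.sum_congr rfl fun c hc => ?_
    rw [Finset.mem_product] at hc
    rw [mass, Finset.filter_filter]
    refine Finset.sum_congr (Finset.filter_congr fun e _ => ?_) fun _ _ => rfl
    constructor
    · rintro ⟨_, h⟩
      rw [← h]; exact ⟨rfl, rfl⟩
    · rintro ⟨h1, h2⟩
      rw [h1, h2]; exact ⟨hc, rfl⟩
  · intro e he
    exact Finset.mem_product.2 (Finset.mem_filter.1 he).2

/-! ### Interpolation and constants -/

/-- The interpolation between the trivial bound `M ≤ X` and the square root bound. -/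
lemma le_of_sq_le_of_le {ε C τ K M X L Q : ℝ} (hε : 0 < ε) (hε' : ε < 1 / 2)
    (hτ : τ * (1 - 2 * ε) = 4 * C * (1 / 2 + ε)) (hM : 0 ≤ M) (hL : 0 ≤ L) (hQ : 0 ≤ Q)
    (hMX : M ≤ X) (h : M ^ 2 ≤ 256 * (L * X * Real.exp (-(τ * K / 2)) * Q ^ 2)) :
    M ≤ (16 * Q) ^ (1 - 2 * ε) *
      (L ^ (1 / 2 - ε) * (X * Real.exp (-(C * K))) ^ (1 / 2 + ε)) := by
  have hX : 0 ≤ X := hM.trans hMX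
  have e1 : M = M ^ (2 * ε) * (M ^ 2) ^ (1 / 2 - ε) := by
    rw [← Real.rpow_natCast, ← Real.rpow_mul hM, ← Real.rpow_add_of_nonneg hM (by linarith)
      (by norm_num; linarith)]
    rw [show 2 * ε + ((2 : ℕ) : ℝ) * (1 / 2 - ε) = 1 by push_cast; ring, Real.rpow_one]
  have h1 : M ^ (2 * ε) ≤ X ^ (2 * ε) := Real.rpow_le_rpow hM hMX (by linarith)
  have h2 : (M ^ 2) ^ (1 / 2 - ε)
      ≤ ((16 * Q) ^ 2 * (L * X * Real.exp (-(τ * K / 2)))) ^ (1 / 2 - ε) :=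
    Real.rpow_le_rpow (by positivity) (h.trans (le_of_eq (by ring))) (by linarith)
  rw [e1]
  refine (mul_le_mul h1 h2 (by positivity) (by positivity)).trans (le_of_eq ?_)
  rw [Real.mul_rpow (by positivity) (by positivity), Real.mul_rpow (by positivity) (by positivity),
    Real.mul_rpow hL hX, Real.mul_rpow hX (by positivity), ← Real.rpow_natCast,
    ← Real.rpow_mul (by positivity), ← Real.exp_mul, ← Real.exp_mul]
  have e2 : X ^ (1 / 2 + ε) = X ^ (2 * ε) * X ^ (1 / 2 - ε) := by
    rw [← Real.rpow_add_of_nonneg hX (by linarith) (by linarith)]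
    congr 1; ring
  have e3 : -(τ * K / 2) * (1 / 2 - ε) = -(C * K) * (1 / 2 + ε) := by
    linear_combination (-K / 4) * hτ
  have e4 : ((2 : ℕ) : ℝ) * (1 / 2 - ε) = 1 - 2 * ε := by push_cast; ring
  rw [e2, e3, e4]
  ring

/-- Convexity of the exponential on `[0, v]`. -/
lemma exp_sub_one_le {u v : ℝ} (hu : 0 ≤ u) (huv : u ≤ v) (hv : 0 < v) :
    Real.exp u - 1 ≤ u / v * (Real.exp v - 1) := by
  have h := convexOn_exp.2 (Set.mem_univ 0) (Set.mem_univ v)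
    (show 0 ≤ 1 - u / v by linarith [(div_le_one hv).2 huv]) (show 0 ≤ u / v by positivity)
    (by ring)
  simp only [smul_eq_mul, mul_zero, zero_add, Real.exp_zero, mul_one] at h
  rw [div_mul_cancel₀ _ hv.ne'] at h
  linarith

/-- The exponent `τ` forced by the interpolation costs only a small part of the allowed power of the
logarithm. -/
lemma interpolation_exponent_le {ε C τ : ℝ} (hε : 0 < ε) (hε' : ε ≤ 2 / 5) (hC : 0 < C)
    (hτ : τ * (1 - 2 * ε) = 4 * C * (1 / 2 + ε)) :
    (1 - 2 * ε) * (Real.exp τ - 1) ≤ 9 / 100 * (Real.exp (40 * C) - 1) := by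
  have hτ0 : 0 ≤ τ := by
    by_contra hc
    push Not at hc
    nlinarith
  have hτ1 : τ ≤ 20 * C := by
    by_contra hc
    push Not at hc
    nlinarith
  have h1 := exp_sub_one_le hτ0 hτ1 (by linarith)
  have h2 := exp_sub_one_le (u := 20 * C) (v := 40 * C) (by linarith) (by linarith) (by linarith)
  have e : 20 * C / (40 * C) = 1 / 2 := by field_simp; norm_num
  rw [e] at h2
  have h3 : 0 ≤ Real.exp (20 * C) - 1 := by
    linarith [Real.one_le_exp (show 0 ≤ 20 * C by linarith)]
  calc (1 - 2 * ε) * (Real.exp τ - 1)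
      ≤ (1 - 2 * ε) * (τ / (20 * C) * (Real.exp (20 * C) - 1)) :=
        mul_le_mul_of_nonneg_left h1 (by linarith)
    _ = (1 / 2 + ε) / 5 * (Real.exp (20 * C) - 1) := by
        have : (1 - 2 * ε) * (τ / (20 * C)) = (1 / 2 + ε) / 5 := by
          rw [← mul_div_assoc, mul_comm, hτ]; field_simp; norm_num
        rw [← mul_assoc, this]
    _ ≤ 9 / 50 * (Real.exp (20 * C) - 1) :=
        mul_le_mul_of_nonneg_right (by linarith) h3
    _ ≤ _ := by linarith

/-- The constant of the square root bound is absorbed by the power of `Log t` and by `p₀`: the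
factor `4` lost in the sum over primes is compensated by the constant `9 / 100`. -/
lemma eulerProd_rpow_le {ε C τ p₀ : ℝ} (hε : 0 < ε) (hε' : ε ≤ 2 / 5) (hC : 0 < C)
    (hτ0 : 0 ≤ τ) (hτ : τ * (1 - 2 * ε) = 4 * C * (1 / 2 + ε)) (ht : 1 ≤ t)
    (hp₀ : 3 + Real.exp (40 * C) ≤ p₀) (hS : ∀ p ∈ S, p.Prime) :
    (16 * eulerProd S t (Real.exp τ)) ^ (1 - 2 * ε)
      ≤ (100 * Real.exp C) ^ p₀ * Log t ^ ((1 / 2 : ℝ) * (Real.exp (40 * C) - 1)) := by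
  classical
  have hL1 : 1 ≤ Log t := le_max_left _ _
  have hlogL : 0 ≤ Real.log (Log t) := Real.log_nonneg hL1
  have hQ0 := eulerProd_nonneg S t (Real.one_le_exp hτ0)
  have hQ : eulerProd S t (Real.exp τ)
      ≤ Real.exp ((Real.exp τ - 1) * (4 * Real.log (Log t) + 10)) :=
    prod_one_add_div_le ht (Real.one_le_exp hτ0) _ fun p hp =>
      ⟨hS p (Finset.mem_filter.1 hp).1, (Finset.mem_filter.1 hp).2⟩
  have hexp : 0 < Real.exp (40 * C) - 1 := by
    linarith [Real.add_one_lt_exp (show 40 * C ≠ 0 by positivity)]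
  have h16 : (16 : ℝ) ≤ Real.exp 3 := by
    have := Real.exp_one_gt_d9
    have h3 : Real.exp 3 = Real.exp 1 ^ 3 := by rw [← Real.exp_nat_mul]; norm_num
    rw [h3]
    calc (16 : ℝ) ≤ 2.7 ^ 3 := by norm_num
      _ ≤ _ := pow_le_pow_left₀ (by norm_num) (by linarith) 3
  have hI := interpolation_exponent_le hε hε' hC hτ
  have h1 : (16 * eulerProd S t (Real.exp τ)) ^ (1 - 2 * ε)
      ≤ Real.exp ((3 + (Real.exp τ - 1) * (4 * Real.log (Log t) + 10)) * (1 - 2 * ε)) := by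
    rw [Real.exp_mul, Real.exp_add]
    exact Real.rpow_le_rpow (by positivity) (mul_le_mul h16 hQ hQ0 (by positivity)) (by linarith)
  have h2 : Real.exp p₀ ≤ (100 * Real.exp C) ^ p₀ := by
    have h0 : 0 < Real.exp (40 * C) := Real.exp_pos _
    calc Real.exp p₀ = Real.exp 1 ^ p₀ := by rw [← Real.exp_mul, one_mul]
      _ ≤ _ := by
        refine Real.rpow_le_rpow (Real.exp_pos _).le ?_ (by linarith)
        have := Real.exp_one_lt_d9
        have := Real.one_le_exp hC.le
        linarith
  refine h1.trans ?_
  refine le_trans ?_ (mul_le_mul_of_nonneg_right h2 (by positivity))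
  rw [Real.rpow_def_of_pos (by linarith), ← Real.exp_add]
  refine Real.exp_le_exp.2 ?_
  nlinarith

/-! ### Induction on the set of primes -/

open Classical in
/-- The number of primes of `S` up to `p₀`. -/
noncomputable def smallCount (p₀ : ℝ) (S : Finset ℕ) : ℕ :=
  (S.filter (fun p : ℕ => (p : ℝ) ≤ p₀)).card

/-- The constant in the mass bound, including the power of the logarithm. -/
noncomputable def massConst (C p₀ t : ℝ) (S : Finset ℕ) : ℝ :=
  (100 * Real.exp C) ^ (p₀ + smallCount p₀ S) * Log t ^ ((1 / 2 : ℝ) * (Real.exp (40 * C) - 1))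

lemma massConst_nonneg (C p₀ t : ℝ) (S : Finset ℕ) : 0 ≤ massConst C p₀ t S := by
  have : 1 ≤ Log t := le_max_left _ _
  unfold massConst
  positivity

lemma massConst_erase_of_le {C p₀ t : ℝ} {p : ℕ} (hp : p ∈ S) (hpp : (p : ℝ) ≤ p₀) :
    massConst C p₀ t (S.erase p) * (100 * Real.exp C) = massConst C p₀ t S := by
  classical
  have h1 : smallCount p₀ S = smallCount p₀ (S.erase p) + 1 := by
    unfold smallCount
    rw [← Finset.card_erase_add_one (Finset.mem_filter.2 ⟨hp, hpp⟩), Finset.filter_erase]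
  unfold massConst
  rw [h1, Nat.cast_add, Nat.cast_one, ← add_assoc, Real.rpow_add_one (by positivity)]
  ring

lemma massConst_erase_of_lt {C p₀ t : ℝ} {p : ℕ} (hpp : p₀ < (p : ℝ)) :
    massConst C p₀ t (S.erase p) = massConst C p₀ t S := by
  have h1 : smallCount p₀ (S.erase p) = smallCount p₀ S := by
    unfold smallCount
    rw [Finset.filter_erase, Finset.erase_eq_of_notMem]
    simp [hpp]
  unfold massConst
  rw [h1]

/-- The kernel sum at an arbitrary prime, used for the primes up to `p₀`. -/
lemma sum_kernel_small_le {ε Z : ℝ} (hε' : ε ≤ 2 / 5) (hZ : 1 ≤ Z) {p : ℕ}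
    (hp : 2 ≤ p) {n : ℕ} {α β : ℕ → ℝ} (hε : 0 < ε) (hα : ∀ i, 0 ≤ α i) (hβ : ∀ i, 0 ≤ β i)
    (hα1 : ∑ i ∈ range n, α i = 1) (hβ1 : ∑ i ∈ range n, β i = 1) :
    ∑ i ∈ range n, ∑ j ∈ range n,
      kernel Z ((p : ℝ) ^ (-(1 / 2 - ε))) i j * (α i * β j) ^ (1 / 2 + ε) ≤ 100 * Z := by
  have hp2 : (2 : ℝ) ≤ p := by exact_mod_cast hp
  set r := (p : ℝ) ^ (-(1 / 2 - ε)) with hr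
  have hr0 : 0 ≤ r := by positivity
  -- The worst case is `p = 2` with `ε = 2 / 5`, where `r = 2 ^ (-1 / 10)`.
  have hr1 : r ≤ 99 / 101 := by
    have h1 : r ≤ (2 : ℝ) ^ (-(1 / 10) : ℝ) := by
      calc r ≤ (p : ℝ) ^ (-(1 / 10) : ℝ) :=
            Real.rpow_le_rpow_of_exponent_le (by linarith) (by linarith)
        _ ≤ _ := Real.rpow_le_rpow_of_nonpos (by norm_num) hp2 (by norm_num)
    refine h1.trans ?_
    rw [Real.rpow_neg (by norm_num), inv_le_comm₀ (by positivity) (by norm_num)]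
    calc (99 / 101 : ℝ)⁻¹ = ((101 / 99 : ℝ) ^ 10) ^ (1 / 10 : ℝ) := by
          rw [← Real.rpow_natCast, ← Real.rpow_mul (by norm_num)]; norm_num
      _ ≤ 2 ^ (1 / 10 : ℝ) := Real.rpow_le_rpow (by norm_num) (by norm_num) (by norm_num)
  have h := sum_kernel_rpow_le (I := range n) (R := Z * 100) (q := 1 / 2 + ε)
    (kernel_nonneg hZ hr0) (kernel_symm Z r) (fun i _ => by
      refine (sum_kernel_le hZ hr0 (by linarith) _ i).trans
        (mul_le_mul_of_nonneg_left ?_ (by linarith))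
      rw [div_le_iff₀ (by linarith)]
      linarith) (by linarith) hα hβ
  rw [hα1, hβ1, one_mul, Real.one_rpow] at h
  linarith

lemma exists_tail_le (c : ℝ) {e : ℝ} (he : 1 < e) :
    ∃ N : ℕ, ∀ S : Finset ℕ, (∀ p ∈ S, N ≤ p) → ∑ p ∈ S, c / (p : ℝ) ^ e ≤ 1 / 2 := by
  have hs : Summable fun n : ℕ => c / (n : ℝ) ^ e := by
    simpa only [div_eq_mul_inv, one_mul] using (Real.summable_nat_rpow_inv.2 he).mul_left c
  obtain ⟨s, hs⟩ := summable_iff_vanishing_norm.1 hs (1 / 2) (by norm_num)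
  refine ⟨s.sup id + 1, fun S hS => ?_⟩
  have := hs S (Finset.disjoint_left.2 fun p hp hps => by
    have h1 := hS p hp
    have h2 : p ≤ s.sup id := Finset.le_sup (f := id) hps
    omega)
  exact (le_abs_self _).trans this.le

lemma sum_share_eq_one (p n : ℕ) (hn : ∀ v ∈ V, x v p < n) (hA : 0 < ∑ v ∈ V, a v) :
    ∑ i ∈ range n, (∑ v ∈ V.filter (fun v => x v p = i), a v) / ∑ v ∈ V, a v = 1 := by
  rw [← Finset.sum_div, Finset.sum_fiberwise_of_maps_to (fun v hv => Finset.mem_range.2 (hn v hv)),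
    div_self hA.ne']

/-- The mass bound for systems, by induction on the set of primes. A prime `p ≤ p₀` is
removed at the cost of a factor `100 e ^ C`. If all primes exceed `p₀` and the bound fails, then the
induction hypothesis for the subsystems with fixed exponents at `p` forces concentration at one
exponent `k p`, for every `p`, and the degree bounds apply. -/
theorem exists_mass_le {ε C : ℝ} (hε : 0 < ε) (hε' : ε ≤ 2 / 5) (hC : 0 < C) :
    ∃ p₀ : ℝ, 0 < p₀ ∧ ∀ {ι κ : Type} (F G : ℕ → ℕ → ℝ) (t : ℝ) (x : ι → ℕ → ℕ)
      (y : κ → ℕ → ℕ) (a : ι → ℝ) (b : κ → ℝ), 1 ≤ t → ∀ (S : Finset ℕ), (∀ p ∈ S, p.Prime) →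
      IsLocalWeight S F → IsLocalWeight S G →
      ∀ (V : Finset ι) (W : Finset κ) (l m K : ℝ) (E : Finset (ι × κ)),
        IsSystem S F G t x y a b V W l m K E →
        mass a b E ≤ massConst C p₀ t S * bound ε C l m (∑ v ∈ V, a v) (∑ w ∈ W, b w) K := by
  classical
  have hZ : 1 ≤ Real.exp C := Real.one_le_exp hC.le
  obtain ⟨p₁, c, hconc⟩ := exists_concentration hε (by linarith) hZ
  obtain ⟨N, hN⟩ := exists_tail_le c (show 1 < 1 + 2 * ε by linarith)
  set p₀ : ℝ := max (max p₁ N) (3 + Real.exp (40 * C)) with hp₀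
  have hp₀1 : p₁ ≤ p₀ := (le_max_left _ _).trans (le_max_left _ _)
  have hp₀N : (N : ℝ) ≤ p₀ := (le_max_right _ _).trans (le_max_left _ _)
  have hp₀e : 3 + Real.exp (40 * C) ≤ p₀ := le_max_right _ _
  refine ⟨p₀, by linarith [Real.exp_pos (40 * C)], ?_⟩
  intro ι κ F G t x y a b ht S
  induction S using Finset.strongInduction with
  | H S ih =>
  intro hS hF hG V W l m K E h
  set A := ∑ v ∈ V, a v with hA
  set B := ∑ w ∈ W, b w with hB
  have hl := h.l_nonneg
  have hm := h.m_nonneg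
  have hA0 : 0 ≤ A := Finset.sum_nonneg fun v _ => h.a_nonneg v
  have hB0 : 0 ≤ B := Finset.sum_nonneg fun w _ => h.b_nonneg w
  have hb0 : 0 ≤ bound ε C l m A B K := by unfold bound; positivity
  have hM0 := h.mass_nonneg E
  rcases hM0.eq_or_lt with hM | hM
  · rw [← hM]; exact mul_nonneg (massConst_nonneg _ _ _ _) hb0
  have hAB : 0 < A * B := hM.trans_le h.mass_le
  have hA1 : 0 < A := pos_of_mul_pos_left hAB hB0
  have hB1 : 0 < B := pos_of_mul_pos_right hAB hA0
  obtain ⟨n, hxn, hyn⟩ : ∃ n, (∀ v ∈ V, ∀ p ∈ S, x v p < n) ∧ ∀ w ∈ W, ∀ p ∈ S, y w p < n := by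
    refine ⟨max ((V ×ˢ S).sup fun e => x e.1 e.2) ((W ×ˢ S).sup fun e => y e.1 e.2) + 1,
      fun v hv p hp => Nat.lt_succ_of_le (le_max_of_le_left ?_),
      fun w hw p hp => Nat.lt_succ_of_le (le_max_of_le_right ?_)⟩
    · exact Finset.le_sup (f := fun e : ι × ℕ => x e.1 e.2) (Finset.mk_mem_product hv hp)
    · exact Finset.le_sup (f := fun e : κ × ℕ => y e.1 e.2) (Finset.mk_mem_product hw hp)
  set α : ℕ → ℕ → ℝ := fun p i => (∑ v ∈ V.filter (fun v => x v p = i), a v) / A with hα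
  set β : ℕ → ℕ → ℝ := fun p i => (∑ w ∈ W.filter (fun w => y w p = i), b w) / B with hβ
  have hα0 : ∀ p i, 0 ≤ α p i := fun p i =>
    div_nonneg (Finset.sum_nonneg fun v _ => h.a_nonneg v) hA0
  have hβ0 : ∀ p i, 0 ≤ β p i := fun p i =>
    div_nonneg (Finset.sum_nonneg fun v _ => h.b_nonneg v) hB0
  have hα1 : ∀ p ∈ S, ∑ i ∈ range n, α p i = 1 := fun p hp =>
    sum_share_eq_one p n (fun v hv => hxn v hv p hp) hA1
  have hβ1 : ∀ p ∈ S, ∑ i ∈ range n, β p i = 1 := fun p hp =>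
    sum_share_eq_one p n (fun v hv => hyn v hv p hp) hB1
  have hstep : ∀ p ∈ S, ∀ i j, mass a b (E.filter fun e => x e.1 p = i ∧ y e.2 p = j)
      ≤ massConst C p₀ t (S.erase p) * bound ε C l m A B K *
        (kernel (Real.exp C) ((p : ℝ) ^ (-(1 / 2 - ε))) i j
          * (α p i * β p j) ^ (1 / 2 + ε)) := by
    intro p hp i j
    refine (ih _ (Finset.erase_ssubset hp) (fun q hq => hS q (Finset.mem_of_mem_erase hq))
      (hF.mono (Finset.erase_subset _ _)) (hG.mono (Finset.erase_subset _ _)) _ _ _ _ _ _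
      (h.restrict hF hG hp i j)).trans ?_
    rw [mul_assoc]
    refine mul_le_mul_of_nonneg_left ?_ (massConst_nonneg _ _ _ _)
    exact bound_restrict_le hε (by linarith) hC hF hG hp (hS p hp) hl hm hA1 hB1
      (Finset.sum_nonneg fun v _ => h.a_nonneg v) (Finset.sum_nonneg fun v _ => h.b_nonneg v) i j
  have htotal : ∀ p ∈ S, mass a b E = ∑ i ∈ range n, ∑ j ∈ range n,
      mass a b (E.filter fun e => x e.1 p = i ∧ y e.2 p = j) := by
    intro p hp
    rw [← mass_eq_sum_sum, Finset.filter_true_of_mem]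
    intro e he
    exact ⟨Finset.mem_range.2 (hxn _ (h.mem e he).1 p hp),
      Finset.mem_range.2 (hyn _ (h.mem e he).2 p hp)⟩
  by_cases hsmall : ∃ p ∈ S, (p : ℝ) ≤ p₀
  · obtain ⟨p, hp, hpp⟩ := hsmall
    rw [htotal p hp, ← massConst_erase_of_le hp hpp]
    refine (Finset.sum_le_sum fun i _ => Finset.sum_le_sum fun j _ => hstep p hp i j).trans ?_
    simp only [← Finset.mul_sum]
    have h1 := mul_le_mul_of_nonneg_left
      (sum_kernel_small_le hε' hZ (hS p hp).two_le hε (hα0 p) (hβ0 p) (hα1 p hp) (hβ1 p hp))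
      (mul_nonneg (massConst_nonneg C p₀ t (S.erase p)) hb0)
    refine h1.trans (le_of_eq ?_)
    ring
  push Not at hsmall
  by_contra hcon
  push Not at hcon
  have hstep' : ∀ p ∈ S, ∀ i j, mass a b (E.filter fun e => x e.1 p = i ∧ y e.2 p = j)
      ≤ mass a b E * (kernel (Real.exp C) ((p : ℝ) ^ (-(1 / 2 - ε))) i j
          * (α p i * β p j) ^ (1 / 2 + ε)) := by
    intro p hp i j
    refine (hstep p hp i j).trans (mul_le_mul_of_nonneg_right ?_ ?_)
    · rw [massConst_erase_of_lt (hsmall p hp)]; exact hcon.le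
    · exact mul_nonneg (kernel_nonneg hZ (by positivity) i j)
        (Real.rpow_nonneg (mul_nonneg (hα0 p i) (hβ0 p j)) _)
  have hexists : ∀ p ∈ S, ∃ k, mass a b (E.filter fun e => x e.1 p ≠ k ∧ y e.2 p ≠ k)
      ≤ mass a b E * (c / (p : ℝ) ^ (1 + 2 * ε)) := by
    intro p hp
    obtain ⟨k, hk⟩ := hconc p (hS p hp).two_le (hp₀1.trans_lt (hsmall p hp)) n (α p) (β p)
      (hα0 p) (hβ0 p) (hα1 p hp) (hβ1 p hp) (by
        have h1 := (htotal p hp).le.trans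
          (Finset.sum_le_sum fun i _ => Finset.sum_le_sum fun j _ => hstep' p hp i j)
        simp only [← Finset.mul_sum] at h1
        exact le_of_mul_le_mul_left (by rwa [mul_one]) hM)
    refine ⟨k, ?_⟩
    have e1 : (E.filter fun e => x e.1 p ≠ k ∧ y e.2 p ≠ k)
        = E.filter fun e => x e.1 p ∈ (range n).erase k ∧ y e.2 p ∈ (range n).erase k := by
      refine Finset.filter_congr fun e he => ?_
      have h1 := hxn _ (h.mem e he).1 p hp
      have h2 := hyn _ (h.mem e he).2 p hp
      simp [h1, h2]
    rw [e1, mass_eq_sum_sum]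
    refine (Finset.sum_le_sum fun i _ => Finset.sum_le_sum fun j _ => hstep' p hp i j).trans ?_
    simp only [← Finset.mul_sum]
    exact mul_le_mul_of_nonneg_left hk hM0
  choose! k hk using hexists
  have hbad : ∑ p ∈ S, mass a b (E.filter fun e => x e.1 p ≠ k p ∧ y e.2 p ≠ k p)
      ≤ mass a b E / 2 := by
    refine (Finset.sum_le_sum hk).trans ?_
    rw [← Finset.mul_sum]
    have := mul_le_mul_of_nonneg_left (hN S fun p hp => by
      exact_mod_cast (hp₀N.trans_lt (hsmall p hp)).le) hM0
    linarith
  set τ : ℝ := 4 * C * (1 / 2 + ε) / (1 - 2 * ε) with hτ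
  have hε2 : 0 < 1 - 2 * ε := by linarith
  have hτ1 : τ * (1 - 2 * ε) = 4 * C * (1 / 2 + ε) := div_mul_cancel₀ _ hε2.ne'
  have hτ0 : 0 ≤ τ := by positivity
  have hsq := h.mass_sq_le hS hF hG hbad hτ0
  have hfin := le_of_sq_le_of_le (K := K) hε (by linarith) hτ1 hM0 (mul_nonneg hl hm)
    (eulerProd_nonneg S t (Real.one_le_exp hτ0)) h.mass_le hsq
  have hconst := eulerProd_rpow_le hε hε' hC hτ0 hτ1 ht hp₀e hS
  refine absurd (hfin.trans (mul_le_mul_of_nonneg_right ?_ hb0)) (not_le.2 hcon)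
  have h0 : smallCount p₀ S = 0 := by
    unfold smallCount
    rw [Finset.card_eq_zero, Finset.filter_eq_empty_iff]
    exact fun p hp => not_le.2 (hsmall p hp)
  rw [massConst, h0, Nat.cast_zero, add_zero]
  exact hconst

end System

/-! ### Translation of the arithmetic problem -/

lemma eq_prod_pow_factorization {S : Finset ℕ} {n : ℕ} (hn : n ≠ 0) (hS : n.primeFactors ⊆ S) :
    n = ∏ p ∈ S, p ^ n.factorization p := by
  conv_lhs => rw [← Nat.prod_factorization_pow_eq_self hn]
  exact Finsupp.prod_of_support_subset _ hS _ fun p _ => pow_zero p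

lemma apply_eq_prod {f : ArithmeticFunction ℝ} (hf : f.IsMultiplicative) {S : Finset ℕ} {n : ℕ}
    (hn : n ≠ 0) (hS : n.primeFactors ⊆ S) : f n = ∏ p ∈ S, f (p ^ n.factorization p) := by
  rw [hf.multiplicative_factorization f hn]
  exact Finsupp.prod_of_support_subset _ hS _ fun p _ => by rw [pow_zero, hf.map_one]

lemma isLocalWeight_of_sum_le {f : ArithmeticFunction ℝ} (hf0 : ∀ n, 0 ≤ f n)
    (hf : ∀ n : ℕ, 1 ≤ n → ((ArithmeticFunction.zeta : ArithmeticFunction ℝ) * f) n ≤ n)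
    {S : Finset ℕ} (hS : ∀ p ∈ S, p.Prime) : IsLocalWeight S fun p i => f (p ^ i) := by
  refine ⟨fun p i => hf0 _, fun p hp m => ?_⟩
  have h := hf (p ^ m) (Nat.one_le_pow _ _ (hS p hp).pos)
  rw [ArithmeticFunction.coe_zeta_mul_apply, Nat.sum_divisors_prime_pow (hS p hp)] at h
  exact_mod_cast h

/-- The condition `w ψ(v) ≤ gcd(v, w)` bounds the weight of `v` by `f(v) / lcm(v, w)`. -/
lemma weight_le_prod {f : ArithmeticFunction ℝ} (hf : f.IsMultiplicative) (hf0 : ∀ n, 0 ≤ f n)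
    {ψ : ℕ → ℝ} {S : Finset ℕ} {v w : ℕ} (hv : v ≠ 0) (hw : w ≠ 0) (hvS : v.primeFactors ⊆ S)
    (hwS : w.primeFactors ⊆ S) (h : (w : ℝ) * ψ v ≤ Nat.gcd v w) :
    weight f ψ v ≤ ∏ p ∈ S, (f (p ^ v.factorization p)
      / (p : ℝ) ^ max (v.factorization p) (w.factorization p)) := by
  have hv0 : (0 : ℝ) < v := by exact_mod_cast Nat.pos_of_ne_zero hv
  have hw0 : (0 : ℝ) < w := by exact_mod_cast Nat.pos_of_ne_zero hw
  have hl : Nat.lcm v w ≠ 0 := Nat.lcm_ne_zero hv hw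
  have hl0 : (0 : ℝ) < Nat.lcm v w := by exact_mod_cast Nat.pos_of_ne_zero hl
  have e1 : (Nat.lcm v w : ℝ)
      = ∏ p ∈ S, (p : ℝ) ^ max (v.factorization p) (w.factorization p) := by
    have h1 : (Nat.lcm v w).primeFactors ⊆ S := by
      refine (Nat.primeFactors_mono (Nat.lcm_dvd_mul v w) (mul_ne_zero hv hw)).trans ?_
      rw [Nat.primeFactors_mul hv hw]; exact Finset.union_subset hvS hwS
    have h2 := eq_prod_pow_factorization hl h1
    rw [Nat.factorization_lcm hv hw] at h2
    rw [h2]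
    push_cast
    rfl
  have hgl : (Nat.gcd v w : ℝ) * Nat.lcm v w = v * w := by exact_mod_cast Nat.gcd_mul_lcm v w
  rw [Finset.prod_div_distrib, ← e1, ← apply_eq_prod hf hv hvS, weight,
    div_le_div_iff₀ hv0 hl0, mul_assoc]
  refine mul_le_mul_of_nonneg_left ?_ (hf0 v)
  refine le_of_mul_le_mul_left ?_ hw0
  calc (w : ℝ) * (ψ v * Nat.lcm v w) = w * ψ v * Nat.lcm v w := by ring
    _ ≤ Nat.gcd v w * Nat.lcm v w := mul_le_mul_of_nonneg_right h hl0.le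
    _ = w * v := by rw [hgl, mul_comm]

lemma omega_le_diffCount {S : Finset ℕ} {v w : ℕ} (hv : v ≠ 0) (hw : w ≠ 0)
    (hS : (v * w).primeFactors ⊆ S) (t : ℝ) :
    omega t v w ≤ diffCount S t v.factorization w.factorization := by
  classical
  have hg : Nat.gcd v w ^ 2 ∣ v * w := by
    rw [sq]; exact mul_dvd_mul (Nat.gcd_dvd_left v w) (Nat.gcd_dvd_right v w)
  unfold omega diffCount
  refine Finset.card_le_card fun p hp => ?_
  rw [Finset.mem_filter] at hp ⊢
  obtain ⟨hp, hpt⟩ := hp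
  have hp' := Nat.mem_primeFactors.1 hp
  refine ⟨hS ?_, hpt, fun hc => ?_⟩
  · exact Nat.mem_primeFactors.2
      ⟨hp'.1, hp'.2.1.trans (Nat.div_dvd_of_dvd hg), mul_ne_zero hv hw⟩
  · have h1 := hp'.1.factorization_pos_of_dvd hp'.2.2 hp'.2.1
    rw [Nat.factorization_div hg, Nat.factorization_mul hv hw, Nat.factorization_pow,
      Nat.factorization_gcd hv hw] at h1
    simp only [Finsupp.coe_tsub, Finsupp.coe_add, Finsupp.coe_smul, Pi.sub_apply, Pi.add_apply,
      Pi.smul_apply, Finsupp.inf_apply, smul_eq_mul, hc, min_self] at h1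
    omega

lemma measure_eq_sum (f ψ : ℕ → ℝ) (V : Set ℕ) (T : Finset ℕ)
    (hT : ∀ v, v ∈ T ↔ v ∈ Function.support ψ ∧ v ∈ V) :
    measure f ψ V = ∑ v ∈ T, weight f ψ v := by
  refine finsum_mem_eq_sum_of_inter_support_eq _ ?_
  ext v
  simp only [Set.mem_inter_iff, Finset.mem_coe, hT, Function.mem_support]
  have : weight f ψ v ≠ 0 → ψ v ≠ 0 := by
    intro h hc
    exact h (by rw [weight, hc, mul_zero, zero_div])
  tauto

end DuffinSchaeffer

theorem mainTheorem1 (ε : ℝ) (hε : ε ∈ Set.Ioc (0 : ℝ) (2 / 5)) (C : ℝ) (hC : 0 < C) :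
    ∃ p₀ : ℝ, 0 < p₀ ∧
      ∀ (ψ θ : ℕ → ℝ),
        (∀ n, 0 ≤ ψ n) → (∀ n, 0 ≤ θ n) → ψ 0 = 0 → θ 0 = 0 →
        (Function.support ψ).Finite → (Function.support θ).Finite →
      ∀ (f g : ArithmeticFunction ℝ),
        f.IsMultiplicative → g.IsMultiplicative →
        (∀ n, 0 ≤ f n) → (∀ n, 0 ≤ g n) →
        (∀ n : ℕ, 1 ≤ n → ((ArithmeticFunction.zeta : ArithmeticFunction ℝ) * f) n ≤ n) →
        (∀ n : ℕ, 1 ≤ n → ((ArithmeticFunction.zeta : ArithmeticFunction ℝ) * g) n ≤ n) →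
      ∀ (t K : ℝ), 1 ≤ t →
      ∀ (V W : Set ℕ) (E : Set (ℕ × ℕ)),
        E ⊆ DuffinSchaeffer.pairSet ψ θ t K ∩ V ×ˢ W →
        DuffinSchaeffer.pairMeasure f g ψ θ E ≤
          (100 * Real.exp C) ^ DuffinSchaeffer.primeBound p₀ ψ θ *
            DuffinSchaeffer.Log t ^ ((1 / 2 : ℝ) * (Real.exp (40 * C) - 1)) *
            (DuffinSchaeffer.measure f ψ V * DuffinSchaeffer.measure g θ W *
              Real.exp (-(C * K))) ^ ((1 / 2 : ℝ) + ε) := by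
  classical
  obtain ⟨p₀, hp₀, hmain⟩ := DuffinSchaeffer.exists_mass_le hε.1 hε.2 hC
  refine ⟨p₀, hp₀, ?_⟩
  intro ψ θ hψ hθ hψ0 hθ0 hψf hθf f g hf hg hf0 hg0 hfs hgs t K ht V W E hE
  have hsuppψ : ∀ v ∈ Function.support ψ, v ≠ 0 := by
    rintro v hv rfl; exact hv hψ0
  have hsuppθ : ∀ w ∈ Function.support θ, w ≠ 0 := by
    rintro w hw rfl; exact hw hθ0
  set Vf : Finset ℕ := hψf.toFinset.filter (· ∈ V) with hVf
  set Wf : Finset ℕ := hθf.toFinset.filter (· ∈ W) with hWf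
  have hmemV : ∀ v, v ∈ Vf ↔ v ∈ Function.support ψ ∧ v ∈ V := fun v => by
    rw [hVf, Finset.mem_filter, Set.Finite.mem_toFinset]
  have hmemW : ∀ w, w ∈ Wf ↔ w ∈ Function.support θ ∧ w ∈ W := fun w => by
    rw [hWf, Finset.mem_filter, Set.Finite.mem_toFinset]
  have hEfin : E.Finite := (hψf.prod hθf).subset fun e he => ⟨(hE he).1.1, (hE he).1.2.1⟩
  have hpm : DuffinSchaeffer.pairMeasure f g ψ θ E = DuffinSchaeffer.mass
      (DuffinSchaeffer.weight f ψ) (DuffinSchaeffer.weight g θ) hEfin.toFinset :=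
    finsum_mem_eq_finite_toFinset_sum _ hEfin
  rw [hpm, DuffinSchaeffer.measure_eq_sum f ψ V Vf hmemV,
    DuffinSchaeffer.measure_eq_sum g θ W Wf hmemW]
  have ha : ∀ v, 0 ≤ DuffinSchaeffer.weight f ψ v := fun v =>
    div_nonneg (mul_nonneg (hf0 v) (hψ v)) (Nat.cast_nonneg v)
  have hb : ∀ w, 0 ≤ DuffinSchaeffer.weight g θ w := fun w =>
    div_nonneg (mul_nonneg (hg0 w) (hθ w)) (Nat.cast_nonneg w)
  rcases E.eq_empty_or_nonempty with hempty | ⟨e₀, he₀⟩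
  · have hLog : 1 ≤ DuffinSchaeffer.Log t := le_max_left _ _
    have hA : 0 ≤ ∑ v ∈ Vf, DuffinSchaeffer.weight f ψ v := Finset.sum_nonneg fun v _ => ha v
    have hB : 0 ≤ ∑ w ∈ Wf, DuffinSchaeffer.weight g θ w := Finset.sum_nonneg fun w _ => hb w
    have h0 : hEfin.toFinset = ∅ := by simpa using hempty
    rw [h0, DuffinSchaeffer.mass, Finset.sum_empty]
    positivity
  obtain ⟨⟨hv₀, hw₀, _⟩, _⟩ := hE he₀
  set S : Finset ℕ := (hψf.toFinset ×ˢ hθf.toFinset).biUnion fun e => (e.1 * e.2).primeFactors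
    with hSdef
  have hSprime : ∀ p ∈ S, p.Prime := by
    intro p hp
    obtain ⟨e, _, he⟩ := Finset.mem_biUnion.1 hp
    exact Nat.prime_of_mem_primeFactors he
  have hmulS : ∀ v ∈ Function.support ψ, ∀ w ∈ Function.support θ, (v * w).primeFactors ⊆ S := by
    intro v hv w hw p hp
    refine Finset.mem_biUnion.2 ⟨(v, w), Finset.mem_product.2 ?_, hp⟩
    exact ⟨hψf.mem_toFinset.2 hv, hθf.mem_toFinset.2 hw⟩
  have hvS : ∀ v ∈ Function.support ψ, v.primeFactors ⊆ S := fun v hv =>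
    (Nat.primeFactors_mono (dvd_mul_right _ _)
      (mul_ne_zero (hsuppψ v hv) (hsuppθ _ hw₀))).trans (hmulS v hv _ hw₀)
  have hwS : ∀ w ∈ Function.support θ, w.primeFactors ⊆ S := fun w hw =>
    (Nat.primeFactors_mono (dvd_mul_left _ _)
      (mul_ne_zero (hsuppψ _ hv₀) (hsuppθ w hw))).trans (hmulS _ hv₀ w hw)
  have hinj : ∀ v v' : ℕ, v ≠ 0 → v' ≠ 0 → v.primeFactors ⊆ S → v'.primeFactors ⊆ S →
      (∀ p ∈ S, v.factorization p = v'.factorization p) → v = v' := by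
    intro v v' hv hv' h1 h2 h
    rw [DuffinSchaeffer.eq_prod_pow_factorization hv h1,
      DuffinSchaeffer.eq_prod_pow_factorization hv' h2]
    exact Finset.prod_congr rfl fun p hp => by rw [h p hp]
  have hD : ∀ e ∈ E, (e.2 : ℝ) * ψ e.1 ≤ Nat.gcd e.1 e.2 ∧ (e.1 : ℝ) * θ e.2 ≤ Nat.gcd e.1 e.2 := by
    intro e he
    obtain ⟨⟨hv, hw, hD, _⟩, _⟩ := hE he
    have hg : (0 : ℝ) < Nat.gcd e.1 e.2 := by
      exact_mod_cast Nat.gcd_pos_of_pos_left _ (Nat.pos_of_ne_zero (hsuppψ _ hv))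
    rw [DuffinSchaeffer.D, div_le_one hg] at hD
    exact max_le_iff.1 hD
  have hsys : DuffinSchaeffer.IsSystem S (fun p i => f (p ^ i)) (fun p i => g (p ^ i)) t
      (fun v p => v.factorization p) (fun w p => w.factorization p)
      (DuffinSchaeffer.weight f ψ) (DuffinSchaeffer.weight g θ) Vf Wf 1 1 K hEfin.toFinset := by
    refine ⟨ha, hb, zero_le_one, zero_le_one, ?_, ?_, ?_, ?_, ?_, ?_⟩
    · intro e he
      obtain ⟨⟨hv, hw, _⟩, hVW⟩ := hE (hEfin.mem_toFinset.1 he)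
      exact ⟨(hmemV _).2 ⟨hv, hVW.1⟩, (hmemW _).2 ⟨hw, hVW.2⟩⟩
    · intro v hv v' hv' h
      have h1 := ((hmemV v).1 hv).1
      have h2 := ((hmemV v').1 hv').1
      exact hinj v v' (hsuppψ v h1) (hsuppψ v' h2) (hvS v h1) (hvS v' h2) h
    · intro v hv v' hv' h
      have h1 := ((hmemW v).1 hv).1
      have h2 := ((hmemW v').1 hv').1
      exact hinj v v' (hsuppθ v h1) (hsuppθ v' h2) (hwS v h1) (hwS v' h2) h
    · intro e he
      rw [hEfin.mem_toFinset] at he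
      obtain ⟨⟨hv, hw, _⟩, _⟩ := hE he
      rw [one_mul]
      exact DuffinSchaeffer.weight_le_prod hf hf0 (hsuppψ _ hv) (hsuppθ _ hw) (hvS _ hv) (hwS _ hw)
        (hD e he).1
    · intro e he
      rw [hEfin.mem_toFinset] at he
      obtain ⟨⟨hv, hw, _⟩, _⟩ := hE he
      rw [one_mul]
      exact DuffinSchaeffer.weight_le_prod hg hg0 (hsuppθ _ hw) (hsuppψ _ hv) (hwS _ hw) (hvS _ hv)
        (by rw [Nat.gcd_comm]; exact (hD e he).2)
    · intro e he
      rw [hEfin.mem_toFinset] at he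
      obtain ⟨⟨hv, hw, _, hK⟩, _⟩ := hE he
      refine hK.trans ?_
      exact_mod_cast DuffinSchaeffer.omega_le_diffCount (hsuppψ _ hv) (hsuppθ _ hw)
        (hmulS _ hv _ hw) t
  have hfinal := hmain _ _ t _ _ _ _ ht S hSprime
    (DuffinSchaeffer.isLocalWeight_of_sum_le hf0 hfs hSprime)
    (DuffinSchaeffer.isLocalWeight_of_sum_le hg0 hgs hSprime) Vf Wf 1 1 K _ hsys
  have hP : DuffinSchaeffer.primeBound p₀ ψ θ = p₀ + DuffinSchaeffer.smallCount p₀ S := by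
    rw [DuffinSchaeffer.primeBound, DuffinSchaeffer.smallCount, ← Set.ncard_coe_finset]
    congr 3
    ext p
    simp only [Set.mem_ofPred_eq, DuffinSchaeffer.primeSet, Set.mem_Icc, Finset.coe_filter, hSdef,
      Finset.mem_biUnion, Finset.mem_product, Set.Finite.mem_toFinset]
    constructor
    · rintro ⟨⟨hp, v, hv, w, hw, hd⟩, _, hpp⟩
      exact ⟨⟨(v, w), ⟨hv, hw⟩, Nat.mem_primeFactors.2
        ⟨hp, hd, mul_ne_zero (hsuppψ v hv) (hsuppθ w hw)⟩⟩, hpp⟩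
    · rintro ⟨⟨e, ⟨hv, hw⟩, hp⟩, hpp⟩
      have h1 := Nat.mem_primeFactors.1 hp
      exact ⟨⟨h1.1, e.1, hv, e.2, hw, h1.2.1⟩, by exact_mod_cast h1.1.one_le, hpp⟩
  rw [hP]
  rw [DuffinSchaeffer.bound, DuffinSchaeffer.massConst, one_mul, Real.one_rpow, one_mul] at hfinal
  exact hfinal
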